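/- Let $\mathscr{M}$ be a bicategory, $\mathscr{W}$ the class of invertible $2$-cells of $\mathscr{M}$ and $X$ a set. Let $\overline{X}$ be the coarse category on $X$ (objects: the elements of $X$; exactly one arrow $(A,B)$ from $A$ to $B$ for all $A,B\in X$). Let $\mathscr{P}_{\overline{X}}$ be its $2$-path-category, i.e. the strict $2$-category with set of objects $X$ in which a $1$-cell from $A$ to $B$ is a chain $[n,s]$ of $n\ge 0$ composable arrows $A=A_0\to A_1\to\cdots\to A_n=B$ of $\overline{X}$, a $2$-cell $[n,s]\to[m,t]$ is a nondecreasing map $u:\{0,\dots,n-1\}\to\{0,\dots,m-1\}$ such that for every $j$ the $j$-th arrow of $t$ is the composite of the arrows of $s$ with index in $u^{-1}(j)$ (an identity if $u^{-1}(j)=\varnothing$), and horizontal composition is concatenation of chains and ordinal sum of maps; the identity of $A$ is $[0,A]$. An $\overline{X}$-point of $(\mathscr{M},\mathscr{W})$ is a colax morphism of bicategories $F:\mathscr{P}_{\overline{X}}\to\mathscr{M}$ all of whose structural $2$-cells $F(t\otimes s)\to F(t)\otimes F(s)$ and $F([0,A])\to \mathrm{Id}_{FA}$ are in $\mathscr{W}$.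 A morphism of $\overline{X}$-points is a transformation of colax morphisms all of whose $1$-cell components are identities. An $\mathscr{M}$-category with set of objects $X$ consists of an object $U_A$ of $\mathscr{M}$ for each $A\in X$ (one says that $A$ is over $U_A$), $1$-cells $\mathscr{A}(A,B):U_A\to U_B$, and $2$-cells $I_A:\mathrm{Id}_{U_A}\Rightarrow\mathscr{A}(A,A)$ and $c_{ABC}:\mathscr{A}(B,C)\otimes\mathscr{A}(A,B)\Rightarrow\mathscr{A}(A,C)$ satisfying the associativity axiom and the left and right unit axioms. A morphism between two of them is an $\mathscr{M}$-functor which is the identity on $X$ (so it preserves the objects $U_A$). Then the following hold. 1. Each $\overline{X}$-point $F$ of $(\mathscr{M},\mathscr{W})$ gives an $\mathscr{M}$-category $\mathscr{M}_F^X$ with set of objects $X$, in which $A$ is over $FA$, $\mathscr{M}_F^X(A,B)=F([1,(A,B)])$, the unit $I_A$ is the composite of the inverse of $F([0,A])\to\mathrm{Id}_{FA}$ with the image under $F$ of the $2$-cell $[0,A]\to[1,(A,A)]$, and $c_{ABC}$ is the composite of the inverse of $F([2,(A,B,C)])\to F([1,(B,C)])\otimes F([1,(A,B)])$ with the image under $F$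 of the $2$-cell $[2,(A,B,C)]\to[1,(A,C)]$. The assignment $F\mapsto\mathscr{M}_F^X$ extends to a functor, sending a morphism $\sigma$ to its components at the chains $[1,(A,B)]$, and this functor is an equivalence from the category of $\overline{X}$-points of $(\mathscr{M},\mathscr{W})$ to the category of $\mathscr{M}$-categories with set of objects $X$. 2. An $\mathscr{M}$-category with set of objects $X$ is the same thing as an $X$-polyad of Bénabou, i.e. a lax morphism of bicategories $\overline{X}\to\mathscr{M}$ (where $\overline{X}$ is regarded as a bicategory with only identity $2$-cells): sending a polyad $P$ to the $\mathscr{M}$-category with $U_A=PA$, $\mathscr{A}(A,B)=P((A,B))$ and with units and compositions the structural $2$-cells of $P$ is a bijection. -/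

import Mathlib

open CategoryTheory Bicategory

universe w v u₁ u u' v'

namespace PathEnrichment

set_option linter.unusedSimpArgs false
set_option linter.unusedVariables false

/-! ### The 2-path-category of a category -/

section PathCategory

variable {C : Type u'} [Category.{v'} C]

/-- Let `s` be a chain of `n` composable arrows from `A` to `B` and `t` a chain of `m` composable
arrows with the same extremities. `IsImage s t u` says that `t` is the image of `s` under the map
`u : {0, …, n-1} → {0, …, m-1}` of `Δ` (given by its values on natural numbers `< n`), that is, the
`j`-th arrow of `t` is the composite of the consecutive arrows of `s` whose index lies in
`u ⁻¹ {j}`; it is an identity when `u ⁻¹ {j}` is empty. -/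
def IsImage {A : C} : ∀ {B : C}, Quiver.Path A B → Quiver.Path A B → (ℕ → ℕ) → Prop
  | _, s, .nil, _ => s = .nil
  | B, s, @Quiver.Path.cons _ _ _ D _ t f, u =>
      ∃ (s' : Quiver.Path A D) (r : Quiver.Path D B), s = s'.comp r ∧ composePath r = f ∧
        (∀ i < s.length, u i < t.length ↔ i < s'.length) ∧ IsImage s' t u

theorem IsImage.congr {A : C} : ∀ {B : C} {s t : Quiver.Path A B} {u u₂ : ℕ → ℕ},
    IsImage s t u → (∀ i < s.length, u i = u₂ i) → IsImage s t u₂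
  | _, _, .nil, _, _, h, _ => h
  | _, _, .cons _ _, _, _, h, e => by
      obtain ⟨s', r, hs, hr, hu, h⟩ := h
      subst hs
      refine ⟨s', r, rfl, hr, fun i hi => by rw [← e i hi]; exact hu i hi, h.congr fun i hi => ?_⟩
      exact e i (by rw [Quiver.Path.length_comp]; omega)

theorem IsImage.split {A D : C} : ∀ {B : C} {s : Quiver.Path A B} {t : Quiver.Path A D}
    {q : Quiver.Path D B} {u : ℕ → ℕ}, IsImage s (t.comp q) u →
    (∀ i < s.length, u i < (t.comp q).length) →
    ∃ (s' : Quiver.Path A D) (r : Quiver.Path D B), s = s'.comp r ∧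
      composePath r = composePath q ∧
      (∀ i < s.length, u i < t.length ↔ i < s'.length) ∧ IsImage s' t u
  | _, s, _, .nil, _, h, hb => ⟨s, .nil, rfl, rfl, fun i hi => ⟨fun _ => hi, fun _ => hb i hi⟩, h⟩
  | _, _, t, .cons q f, u, h, hb => by
      obtain ⟨s', r, hs, hr, hu, h⟩ := h
      subst hs
      obtain ⟨s₁, r₁, rfl, hr₁, hu₁, h₁⟩ := h.split fun i hi =>
        (hu i (by rw [Quiver.Path.length_comp]; omega)).2 hi
      refine ⟨s₁, r₁.comp r, by simp, by simp [hr, hr₁], fun i hi => ?_, h₁⟩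
      have h1 := hu i hi
      have h2 := hu₁ i
      simp only [Quiver.Path.length_comp] at h1 h2
      constructor
      · intro h3
        exact (h2 (h1.1 (by omega))).1 h3
      · intro h3
        exact (h2 (by omega)).2 h3

theorem IsImage.id {A : C} : ∀ {B : C} (s : Quiver.Path A B), IsImage s s fun i => i
  | _, .nil => rfl
  | _, .cons s f => ⟨s, f.toPath, rfl, by simp, fun _ _ => Iff.rfl, IsImage.id s⟩

theorem IsImage.comp {A : C} : ∀ {B : C} {s t p : Quiver.Path A B} {u u₂ : ℕ → ℕ},
    IsImage s t u → IsImage t p u₂ → (∀ i < s.length, u i < t.length) →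
    IsImage s p fun i => u₂ (u i)
  | _, s, t, .nil, u, _, h, h₂, _ => by
      have h₂ : t = .nil := h₂
      subst h₂
      exact h
  | _, s, _, .cons p f, u, u₂, h, h₂, hb => by
      obtain ⟨t', q, ht, hq, hu₂, h₂⟩ := h₂
      subst ht
      obtain ⟨s', r, rfl, hr, hu, h'⟩ := h.split hb
      refine ⟨s', r, rfl, hr.trans hq, fun i hi => (hu₂ _ (hb i hi)).trans (hu i hi),
        h'.comp h₂ fun i hi => ?_⟩
      exact (hu i (by rw [Quiver.Path.length_comp]; omega)).2 hi

theorem IsImage.add {A D : C} : ∀ {B : C} {s t : Quiver.Path A D} {s₂ t₂ : Quiver.Path D B}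
    {u u₂ : ℕ → ℕ}, IsImage s t u → IsImage s₂ t₂ u₂ → (∀ i < s.length, u i < t.length) →
    IsImage (s.comp s₂) (t.comp t₂)
      fun i => if i < s.length then u i else t.length + u₂ (i - s.length)
  | _, s, t, s₂, .nil, u, u₂, h, h₂, _ => by
      have h₂ : s₂ = .nil := h₂
      subst h₂
      exact h.congr fun i hi => (if_pos hi).symm
  | _, s, t, _, .cons t₂ f, u, u₂, h, h₂, hb => by
      obtain ⟨s', r, hs, hr, hu, h'⟩ := h₂
      subst hs
      refine ⟨s.comp s', r, by simp, hr, fun i hi => ?_, h.add h' hb⟩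
      simp only [Quiver.Path.length_comp] at hi hu ⊢
      have h1 := hb i
      have h2 := hu (i - s.length)
      split_ifs with h3
      · have := h1 h3
        omega
      · have := h2 (by omega)
        omega

/-- A 2-cell `[n, s] ⟶ [m, t]` between chains from `A` to `B`: a map `u : n ⟶ m` of the category
`Δ` of all finite ordinals (empty one included) and nondecreasing maps, which sends `s` to `t`. -/
structure PathCell {A B : C} (s t : Quiver.Path A B) where
  /-- The underlying map of `Δ`. -/
  toHom : Fin s.length →o Fin t.length
  isImage : IsImage s t fun i => if h : i < s.length then (toHom ⟨i, h⟩ : ℕ) else 0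

namespace PathCell

variable {A B D E : C}

/-- The values of a 2-cell, as natural numbers (prolonged by a translation). -/
def val {s t : Quiver.Path A B} (η : PathCell s t) (i : ℕ) : ℕ :=
  if h : i < s.length then (η.toHom ⟨i, h⟩ : ℕ) else t.length + (i - s.length)

theorem val_lt {s t : Quiver.Path A B} (η : PathCell s t) {i : ℕ} (hi : i < s.length) :
    η.val i < t.length := by
  rw [val, dif_pos hi]
  exact (η.toHom ⟨i, hi⟩).2

theorem val_of_le {s t : Quiver.Path A B} (η : PathCell s t) {i : ℕ} (hi : s.length ≤ i) :
    η.val i = t.length + (i - s.length) := dif_neg (by omega)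

theorem val_mono {s t : Quiver.Path A B} (η : PathCell s t) {i j : ℕ} (hij : i ≤ j)
    (hj : j < s.length) : η.val i ≤ η.val j := by
  rw [val, val, dif_pos hj, dif_pos (lt_of_le_of_lt hij hj)]
  exact η.toHom.monotone (show (⟨i, _⟩ : Fin s.length) ≤ ⟨j, hj⟩ from hij)

theorem isImage_val {s t : Quiver.Path A B} (η : PathCell s t) : IsImage s t η.val :=
  η.isImage.congr fun i hi => by rw [val, dif_pos hi, dif_pos hi]

theorem ext_val {s t : Quiver.Path A B} {η θ : PathCell s t}
    (h : ∀ i < s.length, η.val i = θ.val i) : η = θ := by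
  have : η.toHom = θ.toHom := by
    ext i
    have := h i i.2
    simpa [val] using this
  cases η
  cases θ
  cases this
  rfl

/-- A 2-cell from a function on natural numbers. -/
def ofNat {s t : Quiver.Path A B} (u : ℕ → ℕ) (hlt : ∀ i < s.length, u i < t.length)
    (hmono : ∀ i j, i ≤ j → j < s.length → u i ≤ u j) (h : IsImage s t u) : PathCell s t where
  toHom := ⟨fun i => ⟨u i, hlt i i.2⟩, fun i j hij => hmono i j hij j.2⟩
  isImage := h.congr fun _ hi => by rw [dif_pos hi]; rfl

theorem val_ofNat {s t : Quiver.Path A B} {u : ℕ → ℕ} {hlt : ∀ i < s.length, u i < t.length}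
    {hmono : ∀ i j, i ≤ j → j < s.length → u i ≤ u j} {h : IsImage s t u} {i : ℕ}
    (hi : i < s.length) : (ofNat u hlt hmono h).val i = u i := by
  rw [val, dif_pos hi]
  rfl

/-- The 2-cell between equal chains given by the identity map of ordinals. -/
def ofEq {s t : Quiver.Path A B} (h : s = t) : PathCell s t :=
  ofNat (fun i => i) (fun i hi => h ▸ hi) (fun _ _ hij _ => hij) (h ▸ IsImage.id s)

theorem val_ofEq {s t : Quiver.Path A B} (h : s = t) (i : ℕ) : (ofEq h).val i = i := by
  by_cases hi : i < s.length
  · exact val_ofNat hi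
  · subst h
    rw [val_of_le _ (by omega)]
    omega

/-- Vertical composition. -/
def vcomp {s t p : Quiver.Path A B} (η : PathCell s t) (θ : PathCell t p) : PathCell s p :=
  ofNat (fun i => θ.val (η.val i)) (fun _ hi => θ.val_lt (η.val_lt hi))
    (fun _ _ hij hj => θ.val_mono (η.val_mono hij hj) (η.val_lt hj))
    (η.isImage_val.comp θ.isImage_val fun _ hi => η.val_lt hi)

theorem val_vcomp {s t p : Quiver.Path A B} (η : PathCell s t) (θ : PathCell t p) (i : ℕ) :
    (η.vcomp θ).val i = θ.val (η.val i) := by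
  by_cases hi : i < s.length
  · exact val_ofNat hi
  · rw [val_of_le _ (by omega), val_of_le η (by omega), val_of_le _ (by omega)]
    omega

/-- Horizontal composition, given by the ordinal sum `u + u'` of maps. -/
def add {s t : Quiver.Path A B} {s₂ t₂ : Quiver.Path B D} (η : PathCell s t)
    (θ : PathCell s₂ t₂) : PathCell (s.comp s₂) (t.comp t₂) :=
  ofNat (fun i => if i < s.length then η.val i else t.length + θ.val (i - s.length))
    (fun i hi => by
      simp only [Quiver.Path.length_comp] at hi ⊢
      split_ifs with h
      · have := η.val_lt h
        omega
      · have := θ.val_lt (i := i - s.length) (by omega)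
        omega)
    (fun i j hij hj => by
      simp only [Quiver.Path.length_comp] at hj
      split_ifs with h h' h'
      · exact η.val_mono hij h'
      · have := η.val_lt h
        omega
      · omega
      · have := θ.val_mono (i := i - s.length) (j := j - s.length) (by omega) (by omega)
        omega)
    (η.isImage_val.add θ.isImage_val fun _ hi => η.val_lt hi)

theorem val_add {s t : Quiver.Path A B} {s₂ t₂ : Quiver.Path B D} (η : PathCell s t)
    (θ : PathCell s₂ t₂) (i : ℕ) : (η.add θ).val i =
      if i < s.length then η.val i else t.length + θ.val (i - s.length) := by
  by_cases hi : i < (s.comp s₂).length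
  · exact val_ofNat hi
  · rw [val_of_le _ (by omega)]
    simp only [Quiver.Path.length_comp] at hi ⊢
    rw [if_neg (by omega), val_of_le _ (by omega)]
    omega

/-- The 2-cell `[n, s] ⟶ [1, f]` over the unique map `n ⟶ 1` of `Δ`, when `f` is the composite
of the chain `s`. -/
def collapse (s : Quiver.Path A B) (f : A ⟶ B) (h : composePath s = f) : PathCell s f.toPath :=
  ofNat (fun _ => 0) (fun _ _ => Nat.one_pos) (fun _ _ _ _ => le_rfl)
    ⟨.nil, s, by simp, h, fun i _ => by simp, rfl⟩

theorem eq_of_toPath {s : Quiver.Path A B} {f : A ⟶ B} (η θ : PathCell s f.toPath) : η = θ :=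
  ext_val fun i hi => by
    have h1 := η.val_lt hi
    have h2 := θ.val_lt hi
    rw [Quiver.Path.length_toPath] at h1 h2
    omega

end PathCell

instance pathCategory (A B : C) : Category (Quiver.Path A B) where
  Hom s t := PathCell s t
  id s := PathCell.ofEq rfl
  comp η θ := PathCell.vcomp η θ
  id_comp η := PathCell.ext_val fun i _ => by simp only [PathCell.val_vcomp, PathCell.val_ofEq]
  comp_id η := PathCell.ext_val fun i _ => by simp only [PathCell.val_vcomp, PathCell.val_ofEq]
  assoc η θ κ := PathCell.ext_val fun i _ => by simp only [PathCell.val_vcomp]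

theorem val_id {A B : C} (s : Quiver.Path A B) (i : ℕ) : PathCell.val (𝟙 s) i = i :=
  PathCell.val_ofEq rfl i

theorem val_comp {A B : C} {s t p : Quiver.Path A B} (η : s ⟶ t) (θ : t ⟶ p) (i : ℕ) :
    PathCell.val (η ≫ θ) i = PathCell.val θ (PathCell.val η i) :=
  PathCell.val_vcomp η θ i

/-- The identity 2-cell between equal chains, as an isomorphism. -/
def isoOfEq {A B : C} {s t : Quiver.Path A B} (h : s = t) : s ≅ t where
  hom := PathCell.ofEq h
  inv := PathCell.ofEq h.symm
  hom_inv_id := PathCell.ext_val fun i _ => by simp only [val_comp, val_id, PathCell.val_ofEq]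
  inv_hom_id := PathCell.ext_val fun i _ => by simp only [val_comp, val_id, PathCell.val_ofEq]

theorem val_isoOfEq_hom {A B : C} {s t : Quiver.Path A B} (h : s = t) (i : ℕ) :
    PathCell.val (isoOfEq h).hom i = i := PathCell.val_ofEq h i

theorem val_isoOfEq_inv {A B : C} {s t : Quiver.Path A B} (h : s = t) (i : ℕ) :
    PathCell.val (isoOfEq h).inv i = i := PathCell.val_ofEq h.symm i

/-- Whiskering of a 2-cell by a chain on the left. -/
def whiskL {A B D : C} (s : Quiver.Path A B) {t t' : Quiver.Path B D} (η : t ⟶ t') :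
    s.comp t ⟶ s.comp t' :=
  PathCell.add (PathCell.ofEq rfl) η

/-- Whiskering of a 2-cell by a chain on the right. -/
def whiskR {A B D : C} {s s' : Quiver.Path A B} (η : s ⟶ s') (t : Quiver.Path B D) :
    s.comp t ⟶ s'.comp t :=
  PathCell.add η (PathCell.ofEq rfl)

theorem val_whiskL {A B D : C} (s : Quiver.Path A B) {t t' : Quiver.Path B D} (η : t ⟶ t')
    (i : ℕ) : PathCell.val (whiskL s η) i =
      if i < s.length then i else s.length + PathCell.val η (i - s.length) := by
  rw [whiskL, PathCell.val_add, PathCell.val_ofEq]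

theorem val_whiskR {A B D : C} {s s' : Quiver.Path A B} (η : s ⟶ s') (t : Quiver.Path B D)
    (i : ℕ) : PathCell.val (whiskR η t) i =
      if i < s.length then PathCell.val η i else s'.length + (i - s.length) := by
  rw [whiskR, PathCell.val_add, PathCell.val_ofEq]

/-- The type of objects of the 2-path-category of `C`, namely the objects of `C`. -/
structure PathBicat (C : Type u') where
  /-- The underlying object. -/
  as : C

/-- The 2-path-category of `C`: 1-cells are chains of composable arrows of `C`, horizontal
composition is concatenation (`s ≫ t` is `t ⊗ s` in the notation of composition from right to
left), and the coherence isomorphisms are identities. -/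
instance pathBicategory : Bicategory (PathBicat C) where
  Hom A B := Quiver.Path A.as B.as
  id A := .nil
  comp s t := s.comp t
  homCategory A B := pathCategory A.as B.as
  whiskerLeft s _ _ η := whiskL s η
  whiskerRight η s := whiskR η s
  associator s t p := isoOfEq (Quiver.Path.comp_assoc s t p)
  leftUnitor s := isoOfEq (Quiver.Path.nil_comp s)
  rightUnitor s := isoOfEq (Quiver.Path.comp_nil s)
  whiskerLeft_id s t := PathCell.ext_val fun i hi => by
    simp only [val_comp, val_id, val_whiskL, val_whiskR, val_isoOfEq_hom, val_isoOfEq_inv,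
      Quiver.Path.length_comp, Quiver.Path.length_nil]
    grind [PathCell.val_lt, PathCell.val_of_le]
  whiskerLeft_comp s _ _ _ η θ := PathCell.ext_val fun i hi => by
    simp only [val_comp, val_id, val_whiskL, val_whiskR, val_isoOfEq_hom, val_isoOfEq_inv,
      Quiver.Path.length_comp, Quiver.Path.length_nil]
    grind [PathCell.val_lt, PathCell.val_of_le]
  id_whiskerLeft η := PathCell.ext_val fun i hi => by
    simp only [val_comp, val_id, val_whiskL, val_whiskR, val_isoOfEq_hom, val_isoOfEq_inv,
      Quiver.Path.length_comp, Quiver.Path.length_nil]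
    grind [PathCell.val_lt, PathCell.val_of_le]
  comp_whiskerLeft s t _ _ η := PathCell.ext_val fun i hi => by
    simp only [val_comp, val_id, val_whiskL, val_whiskR, val_isoOfEq_hom, val_isoOfEq_inv,
      Quiver.Path.length_comp, Quiver.Path.length_nil]
    grind [PathCell.val_lt, PathCell.val_of_le]
  id_whiskerRight s t := PathCell.ext_val fun i hi => by
    simp only [val_comp, val_id, val_whiskL, val_whiskR, val_isoOfEq_hom, val_isoOfEq_inv,
      Quiver.Path.length_comp, Quiver.Path.length_nil]
    grind [PathCell.val_lt, PathCell.val_of_le]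
  comp_whiskerRight η θ t := PathCell.ext_val fun i hi => by
    simp only [val_comp, val_id, val_whiskL, val_whiskR, val_isoOfEq_hom, val_isoOfEq_inv,
      Quiver.Path.length_comp, Quiver.Path.length_nil]
    grind [PathCell.val_lt, PathCell.val_of_le]
  whiskerRight_id η := PathCell.ext_val fun i hi => by
    simp only [val_comp, val_id, val_whiskL, val_whiskR, val_isoOfEq_hom, val_isoOfEq_inv,
      Quiver.Path.length_comp, Quiver.Path.length_nil]
    grind [PathCell.val_lt, PathCell.val_of_le]
  whiskerRight_comp η s t := PathCell.ext_val fun i hi => by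
    simp only [val_comp, val_id, val_whiskL, val_whiskR, val_isoOfEq_hom, val_isoOfEq_inv,
      Quiver.Path.length_comp, Quiver.Path.length_nil]
    grind [PathCell.val_lt, PathCell.val_of_le]
  whisker_assoc s _ _ η t := PathCell.ext_val fun i hi => by
    simp only [val_comp, val_id, val_whiskL, val_whiskR, val_isoOfEq_hom, val_isoOfEq_inv,
      Quiver.Path.length_comp, Quiver.Path.length_nil]
    grind [PathCell.val_lt, PathCell.val_of_le]
  whisker_exchange η θ := PathCell.ext_val fun i hi => by
    simp only [val_comp, val_id, val_whiskL, val_whiskR, val_isoOfEq_hom, val_isoOfEq_inv,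
      Quiver.Path.length_comp, Quiver.Path.length_nil]
    grind [PathCell.val_lt, PathCell.val_of_le]
  pentagon s t p q := PathCell.ext_val fun i hi => by
    simp only [val_comp, val_id, val_whiskL, val_whiskR, val_isoOfEq_hom, val_isoOfEq_inv,
      Quiver.Path.length_comp, Quiver.Path.length_nil]
    grind [PathCell.val_lt, PathCell.val_of_le]
  triangle s t := PathCell.ext_val fun i hi => by
    simp only [val_comp, val_id, val_whiskL, val_whiskR, val_isoOfEq_hom, val_isoOfEq_inv,
      Quiver.Path.length_comp, Quiver.Path.length_nil]
    grind [PathCell.val_lt, PathCell.val_of_le]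
end PathCategory

/-! ### Bases of enrichment and path-objects -/

/-- A base of enrichment structure on a bicategory `M`: a class `W` of 2-cells which contains the
invertible ones, has the vertical `3 out of 2` property and is stable by horizontal composition. -/
structure BaseOfEnrichment (M : Type u₁) [Bicategory.{w, v} M] where
  /-- The class of 2-cells. -/
  W : ∀ a b : M, MorphismProperty (a ⟶ b)
  of_isIso : ∀ {a b : M} {f g : a ⟶ b} (η : f ⟶ g), IsIso η → W a b η
  two_of_three : ∀ a b : M, (W a b).HasTwoOutOfThreeProperty
  hcomp : ∀ {a b c : M} {f f' : a ⟶ b} {g g' : b ⟶ c} (η : f ⟶ f') (θ : g ⟶ g'),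
    W a b η → W b c θ → W a c (η ▷ g ≫ f' ◁ θ)

/-- The base of enrichment given by the invertible 2-cells. -/
def BaseOfEnrichment.invertible (M : Type u₁) [Bicategory.{w, v} M] : BaseOfEnrichment M where
  W a b := MorphismProperty.isomorphisms (a ⟶ b)
  of_isIso _ h := h
  two_of_three _ _ := inferInstance
  hcomp η θ hη hθ := by
    simp only [MorphismProperty.isomorphisms.iff] at *
    infer_instance

/-- A `C`-point (path-object of shape `C`) of `(M, W)`: a `W`-colax morphism from the 2-path-category
of `C` to `M`, that is, a colax morphism whose structural 2-cells lie in `W`. -/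
structure PathObject (C : Type u') [Category.{v'} C] {M : Type u₁} [Bicategory.{w, v} M]
    (𝒲 : BaseOfEnrichment M) extends OplaxFunctor (PathBicat C) M where
  mapComp_mem : ∀ {A B D : PathBicat C} (s : A ⟶ B) (t : B ⟶ D), 𝒲.W _ _ (mapComp s t)
  mapId_mem : ∀ A : PathBicat C, 𝒲.W _ _ (mapId A)

section OverCell

variable {M : Type u₁} [Bicategory.{w, v} M]

/-- For 1-cells `f : a ⟶ b`, `g : a' ⟶ b'` such that `a = a'` and `b = b'`, the 2-cells `f ⟶ g`. -/
def OverCell {a b a' b' : M} (h : a = a') (k : b = b') (f : a ⟶ b) (g : a' ⟶ b') : Type w :=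
  f.cast h k ⟶ g

namespace OverCell

variable {a b c a' b' c' a'' b'' c'' a₃ b₃ : M}

/-- Precomposition with a 2-cell. -/
def pre {h : a = a'} {k : b = b'} {f f₂ : a ⟶ b} {g : a' ⟶ b'} (η : f₂ ⟶ f)
    (σ : OverCell h k f g) : OverCell h k f₂ g :=
  match h, k, g, σ with
  | rfl, rfl, g, σ => (η ≫ (show f ⟶ g from σ) : f₂ ⟶ g)

/-- Postcomposition with a 2-cell. -/
def post {h : a = a'} {k : b = b'} {f : a ⟶ b} {g g₂ : a' ⟶ b'} (σ : OverCell h k f g)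
    (θ : g ⟶ g₂) : OverCell h k f g₂ :=
  σ ≫ θ

/-- The identity 2-cell of a 1-cell. -/
def idc (f : a ⟶ b) : OverCell rfl rfl f f := 𝟙 f

/-- The identity 2-cell of an identity 1-cell. -/
def unit (h : a = a') : OverCell h h (𝟙 a) (𝟙 a') :=
  match h with
  | rfl => 𝟙 (𝟙 a)

/-- Vertical composition. -/
def vcomp {h : a = a'} {k : b = b'} {h' : a' = a''} {k' : b' = b''} {f : a ⟶ b} {g : a' ⟶ b'}
    {i : a'' ⟶ b''} (σ : OverCell h k f g) (τ : OverCell h' k' g i) :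
    OverCell (h.trans h') (k.trans k') f i :=
  match h, k, g, σ, τ with
  | rfl, rfl, _, σ, τ => τ.pre σ

/-- Horizontal composition. -/
def hcomp {h : a = a'} {k : b = b'} {l : c = c'} {f : a ⟶ b} {f' : b ⟶ c} {g : a' ⟶ b'}
    {g' : b' ⟶ c'} (σ : OverCell h k f g) (σ' : OverCell k l f' g') :
    OverCell h l (f ≫ f') (g ≫ g') :=
  match h, k, l, g, g', σ, σ' with
  | rfl, rfl, rfl, g, g', σ, σ' =>
    ((show f ⟶ g from σ) ▷ f' ≫ g ◁ (show f' ⟶ g' from σ') : f ≫ f' ⟶ g ≫ g')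

section lemmas

variable {h : a = a'} {k : b = b'} {l : c = c'} {h' : a' = a''} {k' : b' = b''} {l' : c' = c''}
  {h₂ : a'' = a₃} {k₂ : b'' = b₃} {f f₁ f₂ : a ⟶ b} {g g₁ g₂ : a' ⟶ b'} {i : a'' ⟶ b''}
  {j : a₃ ⟶ b₃} {p : b ⟶ c} {q : b' ⟶ c'} {r : b'' ⟶ c''}

theorem pre_pre (η : f₁ ⟶ f₂) (θ : f₂ ⟶ f) (σ : OverCell h k f g) :
    (σ.pre θ).pre η = σ.pre (η ≫ θ) := by
  subst h k
  exact (Category.assoc _ _ _).symm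

theorem post_post (σ : OverCell h k f g) (η : g ⟶ g₁) (θ : g₁ ⟶ g₂) :
    (σ.post η).post θ = σ.post (η ≫ θ) :=
  Category.assoc _ _ _

theorem pre_post (η : f₁ ⟶ f) (σ : OverCell h k f g) (θ : g ⟶ g₁) :
    (σ.post θ).pre η = (σ.pre η).post θ := by
  subst h k
  exact (Category.assoc _ _ _).symm

theorem pre_id (σ : OverCell h k f g) : σ.pre (𝟙 f) = σ := by
  subst h k
  exact Category.id_comp _

theorem post_id (σ : OverCell h k f g) : σ.post (𝟙 g) = σ :=
  Category.comp_id _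

theorem pre_vcomp (η : f₁ ⟶ f) (σ : OverCell h k f g) (τ : OverCell h' k' g i) :
    (σ.vcomp τ).pre η = (σ.pre η).vcomp τ := by
  subst h k h' k'
  exact (Category.assoc _ _ _).symm

theorem post_vcomp {i₁ : a'' ⟶ b''} (σ : OverCell h k f g) (τ : OverCell h' k' g i)
    (θ : i ⟶ i₁) : (σ.vcomp τ).post θ = σ.vcomp (τ.post θ) := by
  subst h k h' k'
  exact Category.assoc _ _ _

theorem vcomp_mid (σ : OverCell h k f g) (θ : g ⟶ g₁) (τ : OverCell h' k' g₁ i) :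
    (σ.post θ).vcomp τ = σ.vcomp (τ.pre θ) := by
  subst h k h' k'
  exact Category.assoc _ _ _

theorem idc_vcomp (σ : OverCell h k f g) : (idc f).vcomp σ = σ := pre_id σ

theorem vcomp_idc (σ : OverCell h k f g) : σ.vcomp (idc g) = σ := by
  subst h k
  exact Category.comp_id _

theorem vcomp_assoc (σ : OverCell h k f g) (τ : OverCell h' k' g i) (ρ : OverCell h₂ k₂ i j) :
    (σ.vcomp τ).vcomp ρ = σ.vcomp (τ.vcomp ρ) := by
  subst h k h' k' h₂ k₂
  exact Category.assoc _ _ _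

theorem hcomp_vcomp (σ : OverCell h k f g) (τ : OverCell h' k' g i) (σ' : OverCell k l p q)
    (τ' : OverCell k' l' q r) :
    (σ.vcomp τ).hcomp (σ'.vcomp τ') = (σ.hcomp σ').vcomp (τ.hcomp τ') := by
  subst h k l h' k' l'
  have key : ∀ {f g i : a ⟶ b} {p q r : b ⟶ c} (σ : f ⟶ g) (τ : g ⟶ i) (σ' : p ⟶ q)
      (τ' : q ⟶ r), (σ ≫ τ) ▷ p ≫ i ◁ (σ' ≫ τ') = (σ ▷ p ≫ g ◁ σ') ≫ τ ▷ q ≫ i ◁ τ' := by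
    intro f g i p q r σ τ σ' τ'
    simp [whisker_exchange_assoc]
  exact key σ τ σ' τ'

theorem idc_hcomp_idc (f : a ⟶ b) (p : b ⟶ c) : (idc f).hcomp (idc p) = idc (f ≫ p) := by
  change 𝟙 f ▷ p ≫ f ◁ 𝟙 p = 𝟙 (f ≫ p)
  simp

theorem unit_vcomp_unit (h : a = a') (h' : a' = a'') :
    unit (h.trans h') = (unit h).vcomp (unit h') := by
  subst h h'
  exact (Category.id_comp _).symm

theorem idc_pre (η : f ⟶ f₁) : (idc f₁).pre η = (idc f).post η :=
  (Category.comp_id η).trans (Category.id_comp η).symm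

end lemmas

end OverCell

end OverCell

/-- A morphism between two `C`-points `F` and `G`: a transformation `σ : F ⟶ G` of colax morphisms
all of whose 1-cells `σ_A : F A ⟶ G A` are identities. It consists of 2-cells `F t ⟶ G t`, natural
in `t` and compatible with the structural 2-cells of `F` and `G`. -/
@[ext]
structure PathObject.Hom {C : Type u'} [Category.{v'} C] {M : Type u₁} [Bicategory.{w, v} M]
    {𝒲 : BaseOfEnrichment M} (F G : PathObject C 𝒲) where
  obj_eq : ∀ A : PathBicat C, F.obj A = G.obj A
  /-- The component at a 1-cell. -/
  app : ∀ {A B : PathBicat C} (t : A ⟶ B), OverCell (obj_eq A) (obj_eq B) (F.map t) (G.map t)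
  naturality : ∀ {A B : PathBicat C} {s t : A ⟶ B} (η : s ⟶ t),
    (app t).pre (F.map₂ η) = (app s).post (G.map₂ η)
  mapComp_app : ∀ {A B D : PathBicat C} (s : A ⟶ B) (t : B ⟶ D),
    ((app s).hcomp (app t)).pre (F.mapComp s t) = (app (s ≫ t)).post (G.mapComp s t)
  mapId_app : ∀ A : PathBicat C,
    (OverCell.unit (obj_eq A)).pre (F.mapId A) = (app (𝟙 A)).post (G.mapId A)

instance {C : Type u'} [Category.{v'} C] {M : Type u₁} [Bicategory.{w, v} M]
    {𝒲 : BaseOfEnrichment M} : Category (PathObject C 𝒲) where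
  Hom F G := PathObject.Hom F G
  id F :=
    { obj_eq := fun _ => rfl
      app := fun t => OverCell.idc (F.map t)
      naturality := fun η => OverCell.idc_pre _
      mapComp_app := fun s t => by rw [OverCell.idc_hcomp_idc, OverCell.idc_pre]
      mapId_app := fun A => OverCell.idc_pre _ }
  comp σ τ :=
    { obj_eq := fun A => (σ.obj_eq A).trans (τ.obj_eq A)
      app := fun t => (σ.app t).vcomp (τ.app t)
      naturality := fun η => by
        rw [OverCell.pre_vcomp, σ.naturality, OverCell.vcomp_mid, τ.naturality,
          OverCell.post_vcomp]
      mapComp_app := fun s t => by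
        rw [OverCell.hcomp_vcomp, OverCell.pre_vcomp, σ.mapComp_app, OverCell.vcomp_mid,
          τ.mapComp_app, OverCell.post_vcomp]
      mapId_app := fun A => by
        rw [OverCell.unit_vcomp_unit (σ.obj_eq A) (τ.obj_eq A), OverCell.pre_vcomp, σ.mapId_app,
          OverCell.vcomp_mid, τ.mapId_app, OverCell.post_vcomp] }
  id_comp σ := PathObject.Hom.ext (by
    funext A B t
    exact OverCell.idc_vcomp (σ.app t))
  comp_id σ := PathObject.Hom.ext (by
    funext A B t
    exact OverCell.vcomp_idc (σ.app t))
  assoc σ τ ρ := PathObject.Hom.ext (by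
    funext A B t
    exact OverCell.vcomp_assoc (σ.app t) (τ.app t) (ρ.app t))

/-! ### Categories enriched over a bicategory -/

/-- A category enriched over the bicategory `M` with set of objects `X`: every `A : X` lies over an
object `obj A` of `M`, there are 1-cells `hom A B : obj A ⟶ obj B`, units `𝟙 ⟶ hom A A` and
compositions `hom A B ≫ hom B C ⟶ hom A C` (`≫` is written `⊗` in the opposite order when arrows
are composed from right to left), which satisfy the unit and associativity axioms. -/
structure EnrichedCategoryOn (X : Type u) (M : Type u₁) [Bicategory.{w, v} M] where
  /-- The object of `M` over which an element of `X` lies. -/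
  obj : X → M
  /-- The hom 1-cells. -/
  hom : ∀ A B : X, obj A ⟶ obj B
  /-- The unit 2-cells. -/
  unit : ∀ A : X, 𝟙 (obj A) ⟶ hom A A
  /-- The composition 2-cells. -/
  comp : ∀ A B C : X, hom A B ≫ hom B C ⟶ hom A C
  unit_comp : ∀ A B : X, unit A ▷ hom A B ≫ comp A A B = (λ_ (hom A B)).hom
  comp_unit : ∀ A B : X, hom A B ◁ unit B ≫ comp A B B = (ρ_ (hom A B)).hom
  assoc : ∀ A B C D : X, comp A B C ▷ hom C D ≫ comp A C D =
    (α_ (hom A B) (hom B C) (hom C D)).hom ≫ hom A B ◁ comp B C D ≫ comp A B D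

/-- An `M`-functor, identical on objects, between `M`-categories with the same set of objects. -/
@[ext]
structure EnrichedCategoryOn.Hom {X : Type u} {M : Type u₁} [Bicategory.{w, v} M]
    (𝒜 ℬ : EnrichedCategoryOn X M) where
  obj_eq : ∀ A : X, 𝒜.obj A = ℬ.obj A
  /-- The action on hom 1-cells. -/
  app : ∀ A B : X, OverCell (obj_eq A) (obj_eq B) (𝒜.hom A B) (ℬ.hom A B)
  unit_app : ∀ A : X, (app A A).pre (𝒜.unit A) = (OverCell.unit (obj_eq A)).post (ℬ.unit A)
  comp_app : ∀ A B C : X,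
    (app A C).pre (𝒜.comp A B C) = ((app A B).hcomp (app B C)).post (ℬ.comp A B C)

instance {X : Type u} {M : Type u₁} [Bicategory.{w, v} M] :
    Category (EnrichedCategoryOn X M) where
  Hom 𝒜 ℬ := EnrichedCategoryOn.Hom 𝒜 ℬ
  id 𝒜 :=
    { obj_eq := fun _ => rfl
      app := fun A B => OverCell.idc (𝒜.hom A B)
      unit_app := fun A => OverCell.idc_pre _
      comp_app := fun A B C => by rw [OverCell.idc_hcomp_idc, OverCell.idc_pre] }
  comp σ τ :=
    { obj_eq := fun A => (σ.obj_eq A).trans (τ.obj_eq A)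
      app := fun A B => (σ.app A B).vcomp (τ.app A B)
      unit_app := fun A => by
        rw [OverCell.unit_vcomp_unit (σ.obj_eq A) (τ.obj_eq A), OverCell.pre_vcomp, σ.unit_app,
          OverCell.vcomp_mid, τ.unit_app, OverCell.post_vcomp]
      comp_app := fun A B C => by
        rw [OverCell.hcomp_vcomp, OverCell.pre_vcomp, σ.comp_app, OverCell.vcomp_mid,
          τ.comp_app, OverCell.post_vcomp] }
  id_comp σ := EnrichedCategoryOn.Hom.ext (by
    funext A B
    exact OverCell.idc_vcomp (σ.app A B))
  comp_id σ := EnrichedCategoryOn.Hom.ext (by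
    funext A B
    exact OverCell.vcomp_idc (σ.app A B))
  assoc σ τ ρ := EnrichedCategoryOn.Hom.ext (by
    funext A B
    exact OverCell.vcomp_assoc (σ.app A B) (τ.app A B) (ρ.app A B))

/-! ### From points of the coarse category to enriched categories -/

section Coarse

variable {X : Type u} {M : Type u₁} [Bicategory.{w, v} M]

/-- An `X̄`-point of `(M, W)`, where `X̄` is the coarse category with set of objects `X` (exactly one
arrow between any two objects). -/
abbrev CoarsePoint (X : Type u) {M : Type u₁} [Bicategory.{w, v} M] (𝒲 : BaseOfEnrichment M) :=
  PathObject (Codiscrete X) 𝒲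

/-- The object `A` of the 2-path-category of `X̄`. -/
def vert (A : X) : PathBicat (Codiscrete X) := ⟨⟨A⟩⟩

/-- The chain `[1, (A, B)]` of length one. -/
def edge (A B : X) : vert A ⟶ vert B :=
  Quiver.Hom.toPath (Codiscrete.iso (Codiscrete.mk A) (Codiscrete.mk B)).hom

/-- The 2-cell `[2, (A, B, C)] ⟶ [1, (A, C)]` over the map `2 ⟶ 1` of `Δ`. -/
def edgeComp (A B C : X) : edge A B ≫ edge B C ⟶ edge A C :=
  PathCell.collapse _ _ rfl

/-- The 2-cell `[0, A] ⟶ [1, (A, A)]` over the map `0 ⟶ 1` of `Δ`. -/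
def edgeUnit (A : X) : 𝟙 (vert A) ⟶ edge A A :=
  PathCell.collapse _ _ rfl

theorem cell_eq {A B : X} {s : vert A ⟶ vert B} (η θ : s ⟶ edge A B) : η = θ :=
  PathCell.eq_of_toPath η θ

variable (F : CoarsePoint X (BaseOfEnrichment.invertible M))

instance isIso_mapComp {A B D : PathBicat (Codiscrete X)} (s : A ⟶ B) (t : B ⟶ D) :
    IsIso (F.mapComp s t) := F.mapComp_mem s t

instance isIso_mapId (A : PathBicat (Codiscrete X)) : IsIso (F.mapId A) := F.mapId_mem A

theorem map_whiskerRight_inv {A B D : PathBicat (Codiscrete X)} {s s' : A ⟶ B} (η : s ⟶ s')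
    (t : B ⟶ D) : F.map₂ η ▷ F.map t ≫ inv (F.mapComp s' t) =
      inv (F.mapComp s t) ≫ F.map₂ (η ▷ t) := by
  rw [IsIso.comp_inv_eq, Category.assoc, IsIso.eq_inv_comp]
  exact (F.mapComp_naturality_left η t).symm

theorem map_whiskerLeft_inv {A B D : PathBicat (Codiscrete X)} (s : A ⟶ B) {t t' : B ⟶ D}
    (η : t ⟶ t') : F.map s ◁ F.map₂ η ≫ inv (F.mapComp s t') =
      inv (F.mapComp s t) ≫ F.map₂ (s ◁ η) := by
  rw [IsIso.comp_inv_eq, Category.assoc, IsIso.eq_inv_comp]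
  exact (F.mapComp_naturality_right s η).symm

/-- The `M`-category of an `X̄`-point `F`: its hom 1-cells are `F [1, (A, B)]`, and its units and
compositions are obtained by inverting the colaxity 2-cells in
`𝟙 ⟵ F [0, A] ⟶ F [1, (A, A)]` and
`F [1, (A, B)] ≫ F [1, (B, C)] ⟵ F [2, (A, B, C)] ⟶ F [1, (A, C)]`. -/
noncomputable def CoarsePoint.toEnriched : EnrichedCategoryOn X M where
  obj A := F.obj (vert A)
  hom A B := F.map (edge A B)
  unit A := inv (F.mapId (vert A)) ≫ F.map₂ (edgeUnit A)
  comp A B C := inv (F.mapComp (edge A B) (edge B C)) ≫ F.map₂ (edgeComp A B C)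
  unit_comp A B := by
    have h : edgeUnit A ▷ edge A B ≫ edgeComp A A B = (λ_ (edge A B)).hom := cell_eq _ _
    rw [comp_whiskerRight, Category.assoc, ← Category.assoc (F.map₂ _ ▷ _), map_whiskerRight_inv,
      Category.assoc, ← F.map₂_comp, h, F.map₂_leftUnitor, IsIso.inv_hom_id_assoc,
      ← comp_whiskerRight_assoc, IsIso.inv_hom_id, id_whiskerRight, Category.id_comp]
  comp_unit A B := by
    have h : edge A B ◁ edgeUnit B ≫ edgeComp A B B = (ρ_ (edge A B)).hom := cell_eq _ _
    rw [whiskerLeft_comp, Category.assoc, ← Category.assoc (_ ◁ F.map₂ _), map_whiskerLeft_inv,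
      Category.assoc, ← F.map₂_comp, h, F.map₂_rightUnitor, IsIso.inv_hom_id_assoc,
      ← whiskerLeft_comp_assoc, IsIso.inv_hom_id, whiskerLeft_id, Category.id_comp]
  assoc A B C D := by
    have h : edgeComp A B C ▷ edge C D ≫ edgeComp A C D =
        (α_ (edge A B) (edge B C) (edge C D)).hom ≫ edge A B ◁ edgeComp B C D ≫
          edgeComp A B D := cell_eq _ _
    rw [comp_whiskerRight, Category.assoc, ← Category.assoc (F.map₂ _ ▷ _), map_whiskerRight_inv,
      Category.assoc, ← F.map₂_comp, h, whiskerLeft_comp, Category.assoc,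
      ← Category.assoc (_ ◁ F.map₂ _), map_whiskerLeft_inv, Category.assoc, ← F.map₂_comp,
      F.map₂_comp (α_ _ _ _).hom]
    simp only [← Category.assoc]
    congr 1
    simp only [Category.assoc]
    rw [← inv_whiskerRight, ← inv_whiskerLeft, IsIso.inv_comp_eq, IsIso.inv_comp_eq]
    simp only [← Category.assoc]
    rw [IsIso.eq_comp_inv, IsIso.eq_comp_inv]
    simp

/-- The functor sending an `X̄`-point to its `M`-category, and a morphism `σ` of `X̄`-points to the
`M`-functor with components `σ_t` at `t = [1, (A, B)]`. -/
noncomputable def coarsePointToEnriched (X : Type u) (M : Type u₁) [Bicategory.{w, v} M] :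
    CoarsePoint X (BaseOfEnrichment.invertible M) ⥤ EnrichedCategoryOn X M where
  obj F := CoarsePoint.toEnriched F
  map {F G} σ :=
    { obj_eq := fun A => σ.obj_eq (vert A)
      app := fun A B => σ.app (edge A B)
      unit_app := fun A => by
        have h1 := σ.naturality (edgeUnit A)
        have h2 := σ.mapId_app (vert A)
        change (σ.app (edge A A)).pre (inv (F.mapId (vert A)) ≫ F.map₂ (edgeUnit A)) =
          (OverCell.unit (σ.obj_eq (vert A))).post
            (inv (G.mapId (vert A)) ≫ G.map₂ (edgeUnit A))
        rw [← OverCell.pre_pre, h1, OverCell.pre_post, ← OverCell.post_post]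
        congr 1
        have h3 := congrArg (fun τ => (τ.pre (inv (F.mapId (vert A)))).post
          (inv (G.mapId (vert A)))) h2
        simpa [OverCell.pre_pre, OverCell.pre_post, OverCell.post_post, OverCell.pre_id,
          OverCell.post_id] using h3.symm
      comp_app := fun A B C => by
        have h1 := σ.naturality (edgeComp A B C)
        have h2 := σ.mapComp_app (edge A B) (edge B C)
        change (σ.app (edge A C)).pre
            (inv (F.mapComp (edge A B) (edge B C)) ≫ F.map₂ (edgeComp A B C)) =
          ((σ.app (edge A B)).hcomp (σ.app (edge B C))).post
            (inv (G.mapComp (edge A B) (edge B C)) ≫ G.map₂ (edgeComp A B C))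
        rw [← OverCell.pre_pre, h1, OverCell.pre_post, ← OverCell.post_post]
        congr 1
        have h3 := congrArg (fun τ => (τ.pre (inv (F.mapComp (edge A B) (edge B C)))).post
          (inv (G.mapComp (edge A B) (edge B C)))) h2
        simpa [OverCell.pre_pre, OverCell.pre_post, OverCell.post_post, OverCell.pre_id,
          OverCell.post_id] using h3.symm }
  map_id _ := rfl
  map_comp _ _ := rfl

/-- A polyad of Bénabou in `M` on the set `X`: a lax morphism to `M` from the coarse category `X̄`,
viewed as a bicategory with only identity 2-cells. -/
abbrev Polyad (X : Type u) (M : Type u₁) [Bicategory.{w, v} M] :=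
  LaxFunctor (LocallyDiscrete (Codiscrete X)) M

/-- The unique 1-cell `(A, B)` of `X̄`. -/
def arrow (A B : X) :
    (⟨⟨A⟩⟩ : LocallyDiscrete (Codiscrete X)) ⟶ (⟨⟨B⟩⟩ : LocallyDiscrete (Codiscrete X)) :=
  (Codiscrete.iso (Codiscrete.mk A) (Codiscrete.mk B)).hom.toLoc

/-- The `M`-category of a polyad. -/
def Polyad.toEnriched (P : Polyad X M) : EnrichedCategoryOn X M where
  obj A := P.obj ⟨⟨A⟩⟩
  hom A B := P.map (arrow A B)
  unit A := P.mapId ⟨⟨A⟩⟩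
  comp A B C := P.mapComp (arrow A B) (arrow B C)
  unit_comp A B := by
    have h := P.map₂_leftUnitor (arrow A B)
    have h' : P.map₂ (λ_ (arrow A B)).inv = 𝟙 (P.map (arrow A B)) := P.map₂_id _
    rw [h'] at h
    rw [← cancel_epi (λ_ (P.map (arrow A B))).inv, Iso.inv_hom_id]
    exact h.symm
  comp_unit A B := by
    have h := P.map₂_rightUnitor (arrow A B)
    have h' : P.map₂ (ρ_ (arrow A B)).inv = 𝟙 (P.map (arrow A B)) := P.map₂_id _
    rw [h'] at h
    rw [← cancel_epi (ρ_ (P.map (arrow A B))).inv, Iso.inv_hom_id]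
    exact h.symm
  assoc A B C D := by
    have h := P.map₂_associator (arrow A B) (arrow B C) (arrow C D)
    have h' : P.map₂ (α_ (arrow A B) (arrow B C) (arrow C D)).hom = 𝟙 (P.map (arrow A D)) :=
      P.map₂_id _
    rw [h'] at h
    exact (congrArg (_ ≫ ·) (Category.comp_id _)).symm.trans h

end Coarse

end PathEnrichment

/-! Polyads: the coarse category has only identity 2-cells, so `map₂` of a lax functor out of it is
forced, and the data and axioms that remain are those of an enriched category.

Points: up to identities, every 2-cell between chains is built from `edgeUnit` and `edgeComp` by
whiskering and vertical composition. Indeed a cell into a one-arrow chain is unique (`cell_eq`), and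
a cell into a chain `t` followed by an arrow `f` is a cell into `t` placed beside a collapse onto
`f` (`PathCell.exists_eq_whiskerRight_comp_collapse`).

Essential surjectivity: given `𝒜`, a chain goes to the horizontal composite of its hom 1-cells, and
a cell over `u` goes to the 2-cell that composes each fibre of `u` in `𝒜`, an empty fibre giving a
unit. Functoriality is general associativity: `fold_comp` is its basic form, and `IsEval.split`,
`IsEval.comp` and `IsEval.add` carry it to cells. Cutting the source along the fibres is possible
only up to equality of chains, so evaluation is handled as a relation with existence and uniqueness.
The enriched category of the resulting point is `𝒜` up to left unitors.

Full faithfulness: the colaxity 2-cells of the target are invertible, so the components of a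
morphism on single arrows determine all the others. Conversely, components on single arrows extend
recursively to `lift`. Compatibility with concatenation (`isMultiplicative_lift`) is an induction on
the second chain. Naturality (`isNatural_lift`) reduces by generation to `edgeUnit` and `edgeComp`,
where it follows from the axioms of an enriched functor. -/

namespace PathEnrichment

/-! ### Polyads as enriched categories -/

section Polyad

variable {X : Type u} {M : Type u₁} [Bicategory.{w, v} M]

/-- The polyad of an `M`-category. -/
def EnrichedCategoryOn.toPolyad (𝒜 : EnrichedCategoryOn X M) : Polyad X M where
  obj A := 𝒜.obj A.as.as
  map {A B} _ := 𝒜.hom A.as.as B.as.as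
  map₂ _ := 𝟙 _
  mapId A := 𝒜.unit A.as.as
  mapComp {A B C} _ _ := 𝒜.comp A.as.as B.as.as C.as.as
  map₂_id _ := rfl
  map₂_comp _ _ := (Category.comp_id _).symm
  mapComp_naturality_left _ _ := by simp
  mapComp_naturality_right _ _ := by simp
  map₂_associator _ _ _ := by
    simpa using 𝒜.assoc _ _ _ _
  map₂_leftUnitor _ := by
    rw [Iso.eq_inv_comp, Category.comp_id]
    exact (𝒜.unit_comp _ _).symm
  map₂_rightUnitor _ := by
    rw [Iso.eq_inv_comp, Category.comp_id]
    exact (𝒜.comp_unit _ _).symm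

theorem EnrichedCategoryOn.toEnriched_toPolyad (𝒜 : EnrichedCategoryOn X M) :
    Polyad.toEnriched 𝒜.toPolyad = 𝒜 := rfl

theorem Polyad.toPolyad_toEnriched (P : Polyad X M) :
    EnrichedCategoryOn.toPolyad (Polyad.toEnriched P) = P := by
  -- The ascription typechecks because parallel 1-cells of the coarse category are definitionally
  -- equal. So `map₂` is the only field that the round trip could alter.
  have key : ∀ {A B : LocallyDiscrete (Codiscrete X)} {f g : A ⟶ B} (η : f ⟶ g),
      P.map₂ η = (𝟙 (P.map (arrow A.as.as B.as.as)) :) := by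
    intro A B f g η
    obtain rfl := LocallyDiscrete.eq_of_hom η
    exact P.map₂_id _
  obtain ⟨⟨⟨⟨obj, map⟩, map₂⟩, h₁, h₂⟩, mapId, mapComp, h₃, h₄, h₅, h₆, h₇⟩ := P
  have h : @map₂ = fun {A B : LocallyDiscrete (Codiscrete X)} {f g : A ⟶ B} η =>
      (𝟙 (map (arrow A.as.as B.as.as)) :) := by
    funext A B f g η
    exact key η
  subst h
  rfl

theorem Polyad.toEnriched_bijective :
    Function.Bijective (Polyad.toEnriched : Polyad X M → EnrichedCategoryOn X M) :=
  Function.bijective_iff_has_inverse.2 ⟨EnrichedCategoryOn.toPolyad,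
    Polyad.toPolyad_toEnriched, EnrichedCategoryOn.toEnriched_toPolyad⟩

end Polyad

/-! ### Words of hom 1-cells and their iterated composition -/

section Word

variable {X : Type u} {M : Type u₁} [Bicategory.{w, v} M]

namespace EnrichedCategoryOn

variable (𝒜 : EnrichedCategoryOn X M) {A B D E : Codiscrete X}

/-- The horizontal composite in `M` of the hom 1-cells along a chain. -/
@[reducible]
def word {A : Codiscrete X} : ∀ {B : Codiscrete X}, Quiver.Path A B → (𝒜.obj A.as ⟶ 𝒜.obj B.as)
  | _, .nil => 𝟙 _
  | B, @Quiver.Path.cons _ _ _ D _ t _ => word t ≫ 𝒜.hom D.as B.as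

/-- The word of a concatenation is the composite of the words, up to associativity. -/
def wordComp {A D : Codiscrete X} (s : Quiver.Path A D) :
    ∀ {B : Codiscrete X} (t : Quiver.Path D B), 𝒜.word (s.comp t) ≅ 𝒜.word s ≫ 𝒜.word t
  | _, .nil => (ρ_ (𝒜.word s)).symm
  | B, @Quiver.Path.cons _ _ _ E _ t _ =>
      whiskerRightIso (wordComp s t) (𝒜.hom E.as B.as) ≪≫ α_ _ _ _

/-- The iterated composition from the word of a chain to the hom 1-cell of its extremities. -/
def fold {A : Codiscrete X} : ∀ {B : Codiscrete X} (t : Quiver.Path A B),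
    𝒜.word t ⟶ 𝒜.hom A.as B.as
  | _, .nil => 𝒜.unit A.as
  | B, @Quiver.Path.cons _ _ _ D _ t _ => fold t ▷ 𝒜.hom D.as B.as ≫ 𝒜.comp A.as D.as B.as

/-- General associativity, by induction on `t`: the empty chain uses the right unit axiom, and an
added arrow uses the associativity axiom. -/
theorem fold_comp (s : Quiver.Path A D) : ∀ {B : Codiscrete X} (t : Quiver.Path D B),
    𝒜.fold (s.comp t) = (𝒜.wordComp s t).hom ≫ 𝒜.fold s ▷ 𝒜.word t ≫
      𝒜.hom A.as D.as ◁ 𝒜.fold t ≫ 𝒜.comp A.as D.as B.as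
  | _, .nil => by
      simp [fold, wordComp, word, 𝒜.comp_unit]
  | _, .cons t f => by
      simp [fold, wordComp, word, fold_comp s t, 𝒜.assoc]

theorem fold_toPath (f : A ⟶ B) :
    𝒜.fold f.toPath = (λ_ (𝒜.hom A.as B.as)).hom :=
  𝒜.unit_comp A.as B.as

/-- The 2-cell between the words of equal chains. -/
def wordEq {s s' : Quiver.Path A B} (h : s = s') : 𝒜.word s ⟶ 𝒜.word s' :=
  eqToHom (congrArg 𝒜.word h)

@[simp]
theorem wordEq_rfl {s : Quiver.Path A B} (h : s = s) : 𝒜.wordEq h = 𝟙 _ := rfl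

theorem wordEq_cons {s s' : Quiver.Path A D} (h : s = s') (f : D ⟶ B) :
    𝒜.wordEq (congrArg (fun p => Quiver.Path.cons p f) h) =
      𝒜.wordEq h ▷ 𝒜.hom D.as B.as := by
  subst h
  exact (id_whiskerRight _ _).symm

/-- This is `map₂_associator` for `toPoint`. Adding an arrow to `p` whiskers the previous identity
by a hom 1-cell; what remains is coherence in `M`. -/
theorem wordComp_assoc (s : Quiver.Path A B) (t : Quiver.Path B D) :
    ∀ {E : Codiscrete X} (p : Quiver.Path D E),
    𝒜.wordEq (Quiver.Path.comp_assoc s t p) ≫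
      (𝒜.wordComp s (t.comp p)).hom ≫ 𝒜.word s ◁ (𝒜.wordComp t p).hom =
    (𝒜.wordComp (s.comp t) p).hom ≫ (𝒜.wordComp s t).hom ▷ 𝒜.word p ≫
      (α_ (𝒜.word s) (𝒜.word t) (𝒜.word p)).hom
  | _, .nil => by
      change 𝟙 _ ≫ (𝒜.wordComp s t).hom ≫ 𝒜.word s ◁ (ρ_ (𝒜.word t)).inv =
        (ρ_ (𝒜.word (s.comp t))).inv ≫ (𝒜.wordComp s t).hom ▷ 𝟙 _ ≫ (α_ _ _ (𝟙 _)).hom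
      simp
  | E, @Quiver.Path.cons _ _ _ D' _ p f => by
      have h := congrArg (· ▷ 𝒜.hom D'.as E.as) (wordComp_assoc s t p)
      have h' := 𝒜.wordEq_cons (Quiver.Path.comp_assoc s t p) f
      simp only [comp_whiskerRight] at h
      refine (congrArg (· ≫ (𝒜.wordComp s (t.comp (.cons p f))).hom ≫
        𝒜.word s ◁ (𝒜.wordComp t (.cons p f)).hom) h').trans ?_
      change _ ≫ ((𝒜.wordComp s (t.comp p)).hom ▷ 𝒜.hom D'.as E.as ≫ (α_ _ _ _).hom) ≫
        𝒜.word s ◁ ((𝒜.wordComp t p).hom ▷ 𝒜.hom D'.as E.as ≫ (α_ _ _ _).hom) =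
        ((𝒜.wordComp (s.comp t) p).hom ▷ 𝒜.hom D'.as E.as ≫ (α_ _ _ _).hom) ≫
        (𝒜.wordComp s t).hom ▷ (𝒜.word p ≫ 𝒜.hom D'.as E.as) ≫
        (α_ (𝒜.word s) (𝒜.word t) (𝒜.word p ≫ 𝒜.hom D'.as E.as)).hom
      have h₂ := congrArg (· ≫ (α_ (𝒜.word s) (𝒜.word t ≫ 𝒜.word p) (𝒜.hom D'.as E.as)).hom ≫
        𝒜.word s ◁ (α_ (𝒜.word t) (𝒜.word p) (𝒜.hom D'.as E.as)).hom) h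
      simp only [Category.assoc] at h₂
      simpa using h₂

theorem wordComp_nil_left : ∀ {B : Codiscrete X} (p : Quiver.Path A B),
    (𝒜.wordComp .nil p).hom ≫ (λ_ (𝒜.word p)).hom = 𝒜.wordEq (Quiver.Path.nil_comp p)
  | _, .nil => by
      change (ρ_ (𝟙 _)).inv ≫ (λ_ (𝟙 _)).hom = 𝟙 (𝟙 _)
      simp [unitors_equal]
  | B, @Quiver.Path.cons _ _ _ D _ p f => by
      have h := congrArg (· ▷ 𝒜.hom D.as B.as) (wordComp_nil_left p)
      refine Eq.trans ?_ (𝒜.wordEq_cons (Quiver.Path.nil_comp p) f).symm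
      have key : ∀ {a b c : M} {x f : a ⟶ b} (θ : x ⟶ 𝟙 a ≫ f) (g : b ⟶ c),
          (θ ▷ g ≫ (α_ _ _ _).hom) ≫ (λ_ (f ≫ g)).hom = (θ ≫ (λ_ f).hom) ▷ g := by
        intro a b c x f θ g
        simp
      exact (key (𝒜.wordComp .nil p).hom (𝒜.hom D.as B.as)).trans h

/-! ### Evaluation of 2-cells between chains -/

/-- `IsEval s t u φ` says that `φ` is the 2-cell of `M` obtained from the 2-cell `s ⟶ t` over the
map `u` of ordinals: for every `j`, it composes the hom 1-cells of the arrows of `s` with index in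
`u ⁻¹ {j}`. -/
def IsEval {A : Codiscrete X} : ∀ {B : Codiscrete X} (s t : Quiver.Path A B) (_ : ℕ → ℕ)
    (_ : 𝒜.word s ⟶ 𝒜.word t), Prop
  | _, s, .nil, _, φ => ∃ h : s = .nil, φ = 𝒜.wordEq h
  | B, s, @Quiver.Path.cons _ _ _ D _ t _, u, φ =>
      ∃ (s' : Quiver.Path A D) (r : Quiver.Path D B) (h : s = s'.comp r)
        (ψ : 𝒜.word s' ⟶ 𝒜.word t),
        (∀ i < s.length, u i < t.length ↔ i < s'.length) ∧ IsEval s' t u ψ ∧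
        φ = 𝒜.wordEq h ≫ (𝒜.wordComp s' r).hom ≫ ψ ▷ 𝒜.word r ≫ 𝒜.word t ◁ 𝒜.fold r

variable {𝒜}

theorem IsEval.congr : ∀ {B : Codiscrete X} {s t : Quiver.Path A B} {u u₂ : ℕ → ℕ}
    {φ : 𝒜.word s ⟶ 𝒜.word t}, 𝒜.IsEval s t u φ → (∀ i < s.length, u i = u₂ i) →
    𝒜.IsEval s t u₂ φ
  | _, _, .nil, _, _, _, h, _ => h
  | _, _, .cons _ _, _, _, _, h, e => by
      obtain ⟨s', r, hs, ψ, hu, h, hφ⟩ := h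
      subst hs
      refine ⟨s', r, rfl, ψ, fun i hi => by rw [← e i hi]; exact hu i hi, h.congr fun i hi => ?_,
        hφ⟩
      exact e i (by rw [Quiver.Path.length_comp]; omega)

theorem length_eq_of_forall_lt_iff {s s' s₂' : ℕ} {u : ℕ → ℕ} {m : ℕ} (h : s' ≤ s) (h₂ : s₂' ≤ s)
    (hu : ∀ i < s, u i < m ↔ i < s') (hu₂ : ∀ i < s, u i < m ↔ i < s₂') : s' = s₂' := by
  by_contra hne
  -- If the two lengths differ, their minimum is an index below `s` that lies under exactly one of
  -- them.
  have h1 := hu (min s' s₂')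
  have h2 := hu₂ (min s' s₂')
  omega

/-- The map `u` fixes the length of the prefix `s'`, and a chain has at most one cut at a given
length. -/
theorem IsEval.unique : ∀ {B : Codiscrete X} {s t : Quiver.Path A B} {u : ℕ → ℕ}
    {φ φ₂ : 𝒜.word s ⟶ 𝒜.word t}, 𝒜.IsEval s t u φ → 𝒜.IsEval s t u φ₂ → φ = φ₂
  | _, _, .nil, _, _, _, ⟨_, e⟩, ⟨_, e₂⟩ => e.trans e₂.symm
  | _, _, .cons _ _, _, _, _, h, h₂ => by
      obtain ⟨s', r, hs, ψ, hu, h, rfl⟩ := h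
      obtain ⟨s₂', r₂, hs₂, ψ₂, hu₂, h₂, rfl⟩ := h₂
      subst hs
      have hl : s'.length = s₂'.length :=
        length_eq_of_forall_lt_iff (by simp) (by simp [hs₂]) hu hu₂
      obtain ⟨rfl, rfl⟩ := (Quiver.Path.comp_inj' hl).1 hs₂
      rw [h.unique h₂]

theorem IsEval.exists : ∀ {B : Codiscrete X} {s t : Quiver.Path A B} {u : ℕ → ℕ},
    IsImage s t u → ∃ φ, 𝒜.IsEval s t u φ
  | _, _, .nil, _, h => ⟨_, h, rfl⟩
  | _, _, .cons _ _, _, h => by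
      -- The condition on the composite of `r` is dropped: parallel arrows of the coarse category
      -- are equal, so it carries no information.
      obtain ⟨s', r, hs, -, hu, h⟩ := h
      obtain ⟨ψ, hψ⟩ := IsEval.exists h
      exact ⟨_, s', r, hs, ψ, hu, hψ, rfl⟩

theorem IsEval.id : ∀ {B : Codiscrete X} (s : Quiver.Path A B),
    𝒜.IsEval s s (fun i => i) (𝟙 _)
  | _, .nil => ⟨rfl, rfl⟩
  | B, @Quiver.Path.cons _ _ _ D _ s f => by
      refine ⟨s, f.toPath, rfl, 𝟙 _, fun _ _ => Iff.rfl, IsEval.id s, ?_⟩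
      rw [fold_toPath]
      have key : ∀ {a b c : M} (f : a ⟶ b) (g : b ⟶ c), 𝟙 (f ≫ g) = 𝟙 (f ≫ g) ≫
          ((ρ_ f).inv ▷ g ≫ (α_ _ _ _).hom) ≫ 𝟙 f ▷ (𝟙 b ≫ g) ≫ f ◁ (λ_ g).hom := by
        intro a b c f g
        simp
      exact key _ _

/-- The heart of `IsEval.comp`: composing the fibres over a final block `q` and then folding `q` is
the same as folding at once the part `r` of the source that lies over `q`. -/
theorem IsEval.split : ∀ {B : Codiscrete X} {s : Quiver.Path A B} {t : Quiver.Path A D}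
    {q : Quiver.Path D B} {u : ℕ → ℕ} {φ : 𝒜.word s ⟶ 𝒜.word (t.comp q)},
    𝒜.IsEval s (t.comp q) u φ → (∀ i < s.length, u i < (t.comp q).length) →
    ∃ (s' : Quiver.Path A D) (r : Quiver.Path D B) (h : s = s'.comp r)
      (ψ : 𝒜.word s' ⟶ 𝒜.word t),
      (∀ i < s.length, u i < t.length ↔ i < s'.length) ∧ 𝒜.IsEval s' t u ψ ∧
      φ ≫ (𝒜.wordComp t q).hom ≫ 𝒜.word t ◁ 𝒜.fold q =
        𝒜.wordEq h ≫ (𝒜.wordComp s' r).hom ≫ ψ ▷ 𝒜.word r ≫ 𝒜.word t ◁ 𝒜.fold r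
  | _, s, t, .nil, u, φ, h, hb => by
      refine ⟨s, .nil, rfl, φ, fun i hi => ⟨fun _ => hi, fun _ => hb i hi⟩, h, ?_⟩
      have key : ∀ {a b : M} {f g : a ⟶ b} {k : b ⟶ b} (φ : f ⟶ g) (i : 𝟙 b ⟶ k),
          φ ≫ (ρ_ g).inv ≫ g ◁ i = 𝟙 f ≫ (ρ_ f).inv ≫ φ ▷ 𝟙 b ≫ g ◁ i := by
        intro a b f g k φ i
        simp
      exact key φ (𝒜.unit _)
  | B, _, t, @Quiver.Path.cons _ _ _ D' _ q f, u, _, h, hb => by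
      obtain ⟨s', r, hs, ψ, hu, h, rfl⟩ := h
      subst hs
      obtain ⟨s₁, r₁, rfl, ψ₁, hu₁, h₁, e⟩ := h.split fun i hi =>
        (hu i (by rw [Quiver.Path.length_comp]; omega)).2 hi
      refine ⟨s₁, r₁.comp r, by simp, ψ₁, fun i hi => ?_, h₁, ?_⟩
      · have h1 := hu i hi
        have h2 := hu₁ i
        simp only [Quiver.Path.length_comp] at h1 h2
        constructor
        · intro h3
          exact (h2 (h1.1 (by omega))).1 h3
        · intro h3
          exact (h2 (by omega)).2 h3
      · have e₂ := 𝒜.wordComp_assoc s₁ r₁ r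
        rw [wordEq_rfl, Category.id_comp] at e
        -- A pasting identity in `M`: its first hypothesis is the induction hypothesis, its second
        -- the coherence `wordComp_assoc`, and the interchange law moves the fold of the last block
        -- past the others.
        have key : ∀ {a d e b : M} {s₁ t : a ⟶ d} {r₁ q k : d ⟶ e} {r g : e ⟶ b} {l : d ⟶ b}
            {x y : a ⟶ e} {z : d ⟶ b} {m m' : a ⟶ b} {w : x ⟶ s₁ ≫ r₁} {w' : y ⟶ t ≫ q} {ψ : x ⟶ y}
            {ψ₁ : s₁ ⟶ t} (ρ : r ⟶ g) {κ : q ⟶ k} {ρ₁ : r₁ ⟶ k} (c : k ≫ g ⟶ l) {v : m ⟶ x ≫ r}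
            {v' : m ⟶ m'} {p : m' ⟶ s₁ ≫ z} {p' : z ⟶ r₁ ≫ r},
            ψ ≫ w' ≫ t ◁ κ = w ≫ ψ₁ ▷ r₁ ≫ t ◁ ρ₁ →
            v' ≫ p ≫ s₁ ◁ p' = v ≫ w ▷ r ≫ (α_ _ _ _).hom →
            (v ≫ ψ ▷ r ≫ y ◁ ρ) ≫ (w' ▷ g ≫ (α_ _ _ _).hom) ≫ t ◁ (κ ▷ g ≫ c) =
            v' ≫ p ≫ ψ₁ ▷ z ≫ t ◁ (p' ≫ ρ₁ ▷ r ≫ k ◁ ρ ≫ c) := by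
          intro a d e b s₁ t r₁ q k r g l x y z m m' w w' ψ ψ₁ ρ κ ρ₁ c v v' p p' e e₂
          have e' := congrArg (fun χ => v ≫ χ ▷ r ≫ (α_ _ _ _).hom ≫ t ◁ (k ◁ ρ ≫ c)) e
          have e₂' := congrArg (· ≫ ψ₁ ▷ _ ≫ t ◁ (ρ₁ ▷ r ≫ k ◁ ρ ≫ c)) e₂
          simp only [Category.assoc, Bicategory.whiskerLeft_comp]
          have h₃ : t ◁ q ◁ ρ ≫ t ◁ κ ▷ g ≫ t ◁ c = t ◁ κ ▷ r ≫ t ◁ k ◁ ρ ≫ t ◁ c := by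
            rw [← whiskerLeft_comp_assoc, whisker_exchange, whiskerLeft_comp_assoc]
          rw [← whisker_exchange_assoc ψ₁ p', whisker_exchange_assoc w' ρ]
          simp at e' e₂' ⊢
          rw [h₃, e', e₂']
        rw [wordEq_rfl, Category.id_comp]
        exact (key (𝒜.fold r) (𝒜.comp _ _ _) e e₂).trans (by rw [← fold_comp])

theorem IsEval.comp : ∀ {B : Codiscrete X} {s t p : Quiver.Path A B} {u u₂ : ℕ → ℕ}
    {φ : 𝒜.word s ⟶ 𝒜.word t} {φ₂ : 𝒜.word t ⟶ 𝒜.word p},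
    𝒜.IsEval s t u φ → 𝒜.IsEval t p u₂ φ₂ → (∀ i < s.length, u i < t.length) →
    𝒜.IsEval s p (fun i => u₂ (u i)) (φ ≫ φ₂)
  | _, s, t, .nil, u, _, φ, φ₂, h, h₂, _ => by
      obtain ⟨ht, rfl⟩ := h₂
      subst ht
      rw [wordEq_rfl, Category.comp_id]
      exact h
  | _, s, _, .cons p f, u, u₂, φ, φ₂, h, h₂, hb => by
      obtain ⟨t', q, ht, ψ₂, hu₂, h₂, rfl⟩ := h₂
      subst ht
      obtain ⟨s', r, rfl, ψ, hu, h', e⟩ := h.split hb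
      refine ⟨s', r, rfl, ψ ≫ ψ₂, fun i hi => (hu₂ _ (hb i hi)).trans (hu i hi),
        h'.comp h₂ fun i hi => ?_, ?_⟩
      · exact (hu i (by rw [Quiver.Path.length_comp]; omega)).2 hi
      · rw [wordEq_rfl, Category.id_comp] at e
        rw [wordEq_rfl, Category.id_comp]
        have key : ∀ {a d b : M} {s t p : a ⟶ d} {r q g : d ⟶ b} {x y : a ⟶ b} {φ : x ⟶ y}
            {w : x ⟶ s ≫ r} {w' : y ⟶ t ≫ q} {ψ : s ⟶ t} (ψ₂ : t ⟶ p) {ρ : r ⟶ g} {κ : q ⟶ g},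
            φ ≫ w' ≫ t ◁ κ = w ≫ ψ ▷ r ≫ t ◁ ρ →
            φ ≫ w' ≫ ψ₂ ▷ q ≫ p ◁ κ = 𝟙 _ ≫ w ≫ (ψ ≫ ψ₂) ▷ r ≫ p ◁ ρ := by
          intro a d b s t p r q g x y φ w w' ψ ψ₂ ρ κ e
          have e' := congrArg (· ≫ ψ₂ ▷ g) e
          simpa [whisker_exchange] using e'
        exact key ψ₂ e

theorem IsEval.add : ∀ {B : Codiscrete X} {s t : Quiver.Path A D} {s₂ t₂ : Quiver.Path D B}
    {u u₂ : ℕ → ℕ} {φ : 𝒜.word s ⟶ 𝒜.word t} {φ₂ : 𝒜.word s₂ ⟶ 𝒜.word t₂},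
    𝒜.IsEval s t u φ → 𝒜.IsEval s₂ t₂ u₂ φ₂ → (∀ i < s.length, u i < t.length) →
    𝒜.IsEval (s.comp s₂) (t.comp t₂)
      (fun i => if i < s.length then u i else t.length + u₂ (i - s.length))
      ((𝒜.wordComp s s₂).hom ≫ φ ▷ 𝒜.word s₂ ≫ 𝒜.word t ◁ φ₂ ≫ (𝒜.wordComp t t₂).inv)
  | _, s, t, s₂, .nil, u, u₂, φ, φ₂, h, h₂, _ => by
      obtain ⟨hs, rfl⟩ := h₂
      subst hs
      have key : ∀ {a b : M} {f g : a ⟶ b} (φ : f ⟶ g),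
          (ρ_ f).inv ≫ φ ▷ 𝟙 b ≫ g ◁ 𝟙 (𝟙 b) ≫ (ρ_ g).hom = φ := by
        intro a b f g φ
        simp
      have e : (𝒜.wordComp s .nil).hom ≫ φ ▷ 𝒜.word .nil ≫ 𝒜.word t ◁ 𝒜.wordEq rfl ≫
        (𝒜.wordComp t .nil).inv = φ := key φ
      rw [e]
      exact h.congr fun i hi => (if_pos hi).symm
  | _, s, t, _, .cons t₂ f, u, u₂, φ, φ₂, h, h₂, hb => by
      obtain ⟨s', r, hs, ψ, hu, h', rfl⟩ := h₂
      subst hs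
      refine ⟨s.comp s', r, by simp, _, fun i hi => ?_, h.add h' hb, ?_⟩
      · simp only [Quiver.Path.length_comp] at hi hu ⊢
        have h1 := hb i
        have h2 := hu (i - s.length)
        split_ifs with h3
        · have := h1 h3
          omega
        · have := h2 (by omega)
          omega
      · have e₂ := 𝒜.wordComp_assoc s s' r
        rw [wordEq_rfl, Category.id_comp]
        -- Here `v` and `v'` are the mutually inverse identifications of the two bracketings of `s`,
        -- `s'`, `r`; the rest is interchange.
        have key : ∀ {a d e b : M} {s t : a ⟶ d} {s' t₂ : d ⟶ e} {r g : e ⟶ b} {x y : a ⟶ e}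
            {z : d ⟶ b} {m m' : a ⟶ b} {p : m ⟶ s ≫ z} {q : z ⟶ s' ≫ r} {v : m ⟶ m'} {v' : m' ⟶ m}
            {w : m' ⟶ x ≫ r} {w' : x ⟶ s ≫ s'} (φ : s ⟶ t) (ψ : s' ⟶ t₂) (ρ : r ⟶ g)
            (n : t ≫ t₂ ⟶ y), v ≫ v' = 𝟙 _ →
            v' ≫ p ≫ s ◁ q = w ≫ w' ▷ r ≫ (α_ _ _ _).hom →
            p ≫ φ ▷ z ≫ t ◁ (q ≫ ψ ▷ r ≫ t₂ ◁ ρ) ≫ ((α_ _ _ _).inv ≫ n ▷ g) =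
            v ≫ w ≫ (w' ≫ φ ▷ s' ≫ t ◁ ψ ≫ n) ▷ r ≫ y ◁ ρ := by
          intro a d e b s t s' t₂ r g x y z m m' p q v v' w w' φ ψ ρ n hv e
          have e' := congrArg (v ≫ · ≫ φ ▷ _ ≫ t ◁ (ψ ▷ r ≫ t₂ ◁ ρ) ≫ ((α_ _ _ _).inv ≫ n ▷ g)) e
          simp only [comp_whiskerRight, Category.assoc, Bicategory.whiskerLeft_comp]
          rw [← whisker_exchange_assoc φ q, ← whisker_exchange n ρ]
          simp [reassoc_of% hv] at e' ⊢
          exact e'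
        exact key φ ψ (𝒜.fold r) (𝒜.wordComp t t₂).inv (by simp [wordEq]) e₂

variable (𝒜)

/-- The 2-cell of `M` between the words of chains given by a 2-cell between these chains. -/
noncomputable def eval {s t : Quiver.Path A B} (η : PathCell s t) : 𝒜.word s ⟶ 𝒜.word t :=
  (IsEval.exists η.isImage_val).choose

theorem isEval_eval {s t : Quiver.Path A B} (η : PathCell s t) :
    𝒜.IsEval s t η.val (𝒜.eval η) :=
  (IsEval.exists η.isImage_val).choose_spec

-- Turns each computation of `eval` into the exhibition of a witness of `IsEval`, whose map need
-- agree with `η` only on the indices of `s`.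
variable {𝒜} in
theorem IsEval.eval_eq {s t : Quiver.Path A B} {η : PathCell s t} {u : ℕ → ℕ}
    {φ : 𝒜.word s ⟶ 𝒜.word t} (h : 𝒜.IsEval s t u φ) (hu : ∀ i < s.length, η.val i = u i) :
    𝒜.eval η = φ :=
  ((𝒜.isEval_eval η).congr hu).unique h

theorem eval_ofEq {s t : Quiver.Path A B} (h : s = t) :
    𝒜.eval (PathCell.ofEq h) = 𝒜.wordEq h := by
  subst h
  exact (IsEval.id s).eval_eq fun i _ => PathCell.val_ofEq rfl i

theorem eval_vcomp {s t p : Quiver.Path A B} (η : PathCell s t) (θ : PathCell t p) :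
    𝒜.eval (η.vcomp θ) = 𝒜.eval η ≫ 𝒜.eval θ :=
  ((𝒜.isEval_eval η).comp (𝒜.isEval_eval θ) fun _ hi => η.val_lt hi).eval_eq
    fun i _ => PathCell.val_vcomp η θ i

theorem eval_add {s t : Quiver.Path A B} {s₂ t₂ : Quiver.Path B D} (η : PathCell s t)
    (θ : PathCell s₂ t₂) : 𝒜.eval (η.add θ) =
      (𝒜.wordComp s s₂).hom ≫ 𝒜.eval η ▷ 𝒜.word s₂ ≫ 𝒜.word t ◁ 𝒜.eval θ ≫
        (𝒜.wordComp t t₂).inv :=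
  ((𝒜.isEval_eval η).add (𝒜.isEval_eval θ) fun _ hi => η.val_lt hi).eval_eq
    fun i _ => PathCell.val_add η θ i

theorem eval_collapse (s : Quiver.Path A B) (f : A ⟶ B) (h : composePath s = f) :
    𝒜.eval (PathCell.collapse s f h) = 𝒜.fold s ≫ (λ_ (𝒜.hom A.as B.as)).inv := by
  refine IsEval.eval_eq (u := fun _ => 0) (?_ : 𝒜.IsEval s (.cons .nil f) _ _)
    fun i hi => PathCell.val_ofNat hi
  -- No index is sent below the single arrow, so the prefix is empty and the whole of `s` is folded.
  refine ⟨.nil, s, (Quiver.Path.nil_comp s).symm, 𝟙 _, fun i _ => by simp, ⟨rfl, rfl⟩, ?_⟩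
  have h₁ := 𝒜.wordComp_nil_left s
  have h₂ : 𝒜.wordEq (Quiver.Path.nil_comp s).symm ≫ 𝒜.wordEq (Quiver.Path.nil_comp s) = 𝟙 _ := by
    simp [wordEq]
  have key : ∀ {a b : M} {x y g : a ⟶ b} (w : x ⟶ 𝟙 a ≫ y) (e : y ⟶ x) (e' : x ⟶ y) (k : y ⟶ g),
      w ≫ (λ_ y).hom = e' → e ≫ e' = 𝟙 _ →
      k ≫ (λ_ g).inv = e ≫ w ≫ 𝟙 (𝟙 a) ▷ y ≫ 𝟙 a ◁ k := by
    intro a b x y g w e e' k h h'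
    subst h
    have h₃ := congrArg (· ≫ k ≫ (λ_ g).inv) h'
    simpa using h₃.symm
  exact key _ _ _ (𝒜.fold s) h₁ h₂

/-! ### The point of an enriched category and essential surjectivity -/

/-- The point of the coarse category on `X` given by an `M`-category with set of objects `X`. -/
noncomputable def toPoint : CoarsePoint X (BaseOfEnrichment.invertible M) where
  obj A := 𝒜.obj A.as.as
  map s := 𝒜.word s
  map₂ η := 𝒜.eval η
  map₂_id s := 𝒜.eval_ofEq rfl
  map₂_comp η θ := 𝒜.eval_vcomp η θ
  mapId _ := 𝟙 _
  mapComp s t := (𝒜.wordComp s t).hom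
  mapComp_naturality_left η t := by
    have h := 𝒜.eval_add η (PathCell.ofEq (rfl : t = t))
    rw [eval_ofEq, wordEq_rfl, whiskerLeft_id, Category.id_comp] at h
    refine (congrArg (· ≫ (𝒜.wordComp _ t).hom) h).trans ?_
    simp
  mapComp_naturality_right s _ _ η := by
    have h := 𝒜.eval_add (PathCell.ofEq (rfl : s = s)) η
    rw [eval_ofEq, wordEq_rfl, id_whiskerRight, Category.id_comp] at h
    refine (congrArg (· ≫ (𝒜.wordComp s _).hom) h).trans ?_
    simp
  map₂_associator s t p := by
    refine Eq.trans ?_ (𝒜.wordComp_assoc s t p)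
    exact congrArg (· ≫ _) (𝒜.eval_ofEq (Quiver.Path.comp_assoc s t p))
  map₂_leftUnitor s := by
    refine (𝒜.eval_ofEq (Quiver.Path.nil_comp s)).trans ((𝒜.wordComp_nil_left s).symm.trans ?_)
    have key : ∀ {a b : M} {x y : a ⟶ b} (w : x ⟶ 𝟙 a ≫ y),
        w ≫ (λ_ y).hom = w ≫ 𝟙 (𝟙 a) ▷ y ≫ (λ_ y).hom := by
      intro a b x y w
      simp
    exact key _
  map₂_rightUnitor s := by
    refine (𝒜.eval_ofEq (Quiver.Path.comp_nil s)).trans ?_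
    have key : ∀ {a b : M} (x : a ⟶ b), 𝟙 x = (ρ_ x).inv ≫ x ◁ 𝟙 (𝟙 b) ≫ (ρ_ x).hom := by
      intro a b x
      simp
    exact key _
  mapComp_mem s t := inferInstanceAs (IsIso (𝒜.wordComp s t).hom)
  mapId_mem A := inferInstanceAs (IsIso (𝟙 (𝟙 (𝒜.obj A.as.as))))

variable (𝒜 : EnrichedCategoryOn X M)

theorem toEnriched_toPoint_unit (A : X) :
    (CoarsePoint.toEnriched 𝒜.toPoint).unit A =
      𝒜.unit A ≫ (λ_ (𝒜.hom A A)).inv := by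
  have h : 𝒜.eval (edgeUnit A) = 𝒜.unit A ≫ (λ_ (𝒜.hom A A)).inv := 𝒜.eval_collapse _ _ _
  refine (congrArg (inv (𝒜.toPoint.mapId (vert A)) ≫ ·) h).trans ?_
  refine (IsIso.inv_comp_eq _).2 ?_
  exact (Category.id_comp _).symm

/-- Evaluating `edgeComp` gives the fold of a two-arrow chain. `fold_comp` cuts it at the middle,
producing a factor `wordComp` that cancels the inverted colaxity cell. -/
theorem toEnriched_toPoint_comp (A B C : X) :
    (CoarsePoint.toEnriched 𝒜.toPoint).comp A B C =
      (λ_ (𝒜.hom A B)).hom ▷ (𝟙 _ ≫ 𝒜.hom B C) ≫ 𝒜.hom A B ◁ (λ_ (𝒜.hom B C)).hom ≫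
        𝒜.comp A B C ≫ (λ_ (𝒜.hom A C)).inv := by
  have h : 𝒜.eval (edgeComp A B C) =
      𝒜.fold (Quiver.Path.comp (edge A B) (edge B C)) ≫ (λ_ (𝒜.hom A C)).inv :=
    𝒜.eval_collapse _ _ _
  rw [fold_comp] at h
  have hA := 𝒜.fold_toPath (Codiscrete.iso (Codiscrete.mk A) (Codiscrete.mk B)).hom
  have hB := 𝒜.fold_toPath (Codiscrete.iso (Codiscrete.mk B) (Codiscrete.mk C)).hom
  refine (congrArg (inv (𝒜.toPoint.mapComp (edge A B) (edge B C)) ≫ ·) h).trans ?_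
  refine (IsIso.inv_comp_eq _).2 ((Category.assoc _ _ _).trans ?_)
  refine congrArg ((𝒜.wordComp (edge A B) (edge B C)).hom ≫ ·) ?_
  refine Eq.trans ?_ (congrArg₂ (fun x y => x ▷ (𝟙 _ ≫ 𝒜.hom B C) ≫ 𝒜.hom A B ◁ y ≫
    𝒜.comp A B C ≫ (λ_ (𝒜.hom A C)).inv) hA hB)
  exact (Category.assoc _ _ _).trans (congrArg (_ ≫ ·) (Category.assoc _ _ _))

/-- The `M`-category of the point of an `M`-category `𝒜` is isomorphic to `𝒜`. -/
noncomputable def toPointIso : (coarsePointToEnriched X M).obj 𝒜.toPoint ≅ 𝒜 where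
  hom :=
    { obj_eq := fun _ => rfl
      -- The word of a one-arrow chain starts from the empty word, hence is `𝟙 _ ≫ 𝒜.hom A B`.
      app := fun A B => (λ_ (𝒜.hom A B)).hom
      unit_app := fun A => by
        refine (congrArg (· ≫ (λ_ (𝒜.hom A A)).hom) (𝒜.toEnriched_toPoint_unit A)).trans ?_
        exact ((Category.assoc _ _ _).trans (congrArg (𝒜.unit A ≫ ·)
          (λ_ (𝒜.hom A A)).inv_hom_id)).trans
            ((Category.comp_id _).trans (Category.id_comp _).symm)
      comp_app := fun A B C => by
        refine (congrArg (· ≫ (λ_ (𝒜.hom A C)).hom) (𝒜.toEnriched_toPoint_comp A B C)).trans ?_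
        have key : ∀ {a b c : M} (f : a ⟶ b) (g : b ⟶ c) {k : a ⟶ c} (θ : f ≫ g ⟶ k),
            ((λ_ f).hom ▷ (𝟙 b ≫ g) ≫ f ◁ (λ_ g).hom ≫ θ ≫ (λ_ k).inv) ≫ (λ_ k).hom =
              ((λ_ f).hom ▷ (𝟙 b ≫ g) ≫ f ◁ (λ_ g).hom) ≫ θ := by
          intro a b c f g k θ
          simp only [Category.assoc, Iso.inv_hom_id, Category.comp_id]
        exact key _ _ _ }
  inv :=
    { obj_eq := fun _ => rfl
      app := fun A B => (λ_ (𝒜.hom A B)).inv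
      unit_app := fun A => by
        refine Eq.trans ?_ (congrArg (𝟙 (𝟙 _) ≫ ·) (𝒜.toEnriched_toPoint_unit A).symm)
        exact (Category.id_comp _).symm
      comp_app := fun A B C => by
        refine Eq.trans ?_ (congrArg (((λ_ (𝒜.hom A B)).inv ▷ 𝒜.hom B C ≫
          (𝟙 _ ≫ 𝒜.hom A B) ◁ (λ_ (𝒜.hom B C)).inv) ≫ ·) (𝒜.toEnriched_toPoint_comp A B C).symm)
        have key : ∀ {a b c : M} (f : a ⟶ b) (g : b ⟶ c) {k : a ⟶ c} (θ : f ≫ g ⟶ k),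
            θ ≫ (λ_ k).inv = ((λ_ f).inv ▷ g ≫ (𝟙 a ≫ f) ◁ (λ_ g).inv) ≫
              (λ_ f).hom ▷ (𝟙 b ≫ g) ≫ f ◁ (λ_ g).hom ≫ θ ≫ (λ_ k).inv := by
          intro a b c f g k θ
          rw [Category.assoc, whisker_exchange_assoc, whiskerLeft_inv_hom_assoc,
            inv_hom_whiskerRight_assoc]
        exact key _ _ _ }
  hom_inv_id := EnrichedCategoryOn.Hom.ext (by
    funext A B
    exact (λ_ (𝒜.hom A B)).hom_inv_id)
  inv_hom_id := EnrichedCategoryOn.Hom.ext (by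
    funext A B
    exact (λ_ (𝒜.hom A B)).inv_hom_id)

end EnrichedCategoryOn

instance : (coarsePointToEnriched X M).EssSurj where
  mem_essImage 𝒜 := ⟨𝒜.toPoint, ⟨𝒜.toPointIso⟩⟩

end Word

/-! ### Interchange and coherence for 2-cells over equal objects -/

namespace OverCell

variable {M : Type u₁} [Bicategory.{w, v} M]
variable {a b c d a' b' c' d' : M} {h : a = a'} {k : b = b'} {l : c = c'} {m : d = d'}
  {f f₁ : a ⟶ b} {g g₁ : a' ⟶ b'} {p p₁ : b ⟶ c} {q q₁ : b' ⟶ c'} {i : c ⟶ d} {j : c' ⟶ d'}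

theorem pre_hcomp (η : f₁ ⟶ f) (σ : OverCell h k f g) (τ : OverCell k l p q) :
    (σ.pre η).hcomp τ = (σ.hcomp τ).pre (η ▷ p) := by
  subst h k l
  -- Once the equalities of objects are substituted, these are ordinary 2-cells; the same reduction
  -- serves the lemmas below.
  have key : ∀ {f g : a ⟶ b} {p q : b ⟶ c} (η : f₁ ⟶ f) (σ : f ⟶ g) (τ : p ⟶ q),
      (η ≫ σ) ▷ p ≫ g ◁ τ = η ▷ p ≫ σ ▷ p ≫ g ◁ τ := by
    intros
    simp
  exact key η σ τ

theorem hcomp_pre (σ : OverCell h k f g) (θ : p₁ ⟶ p) (τ : OverCell k l p q) :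
    σ.hcomp (τ.pre θ) = (σ.hcomp τ).pre (f ◁ θ) := by
  subst h k l
  have key : ∀ {f g : a ⟶ b} {p₁ p q : b ⟶ c} (σ : f ⟶ g) (θ : p₁ ⟶ p) (τ : p ⟶ q),
      σ ▷ p₁ ≫ g ◁ (θ ≫ τ) = f ◁ θ ≫ σ ▷ p ≫ g ◁ τ := by
    intro f g p₁ p q σ θ τ
    rw [whisker_exchange_assoc, Bicategory.whiskerLeft_comp]
  exact key σ θ τ

theorem post_hcomp (σ : OverCell h k f g) (η : g ⟶ g₁) (τ : OverCell k l p q) :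
    (σ.post η).hcomp τ = (σ.hcomp τ).post (η ▷ q) := by
  subst h k l
  have key : ∀ {f g g₁ : a ⟶ b} {p q : b ⟶ c} (σ : f ⟶ g) (η : g ⟶ g₁) (τ : p ⟶ q),
      (σ ≫ η) ▷ p ≫ g₁ ◁ τ = (σ ▷ p ≫ g ◁ τ) ≫ η ▷ q := by
    intro f g g₁ p q σ η τ
    rw [Category.assoc, whisker_exchange, comp_whiskerRight, Category.assoc]
  exact key σ η τ

theorem hcomp_post (σ : OverCell h k f g) (τ : OverCell k l p q) (θ : q ⟶ q₁) :
    σ.hcomp (τ.post θ) = (σ.hcomp τ).post (g ◁ θ) := by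
  subst h k l
  have key : ∀ {f g : a ⟶ b} {p q q₁ : b ⟶ c} (σ : f ⟶ g) (τ : p ⟶ q) (θ : q ⟶ q₁),
      σ ▷ p ≫ g ◁ (τ ≫ θ) = (σ ▷ p ≫ g ◁ τ) ≫ g ◁ θ := by
    intros
    simp
  exact key σ τ θ

theorem hcomp_assoc (σ : OverCell h k f g) (τ : OverCell k l p q) (ρ : OverCell l m i j) :
    ((σ.hcomp τ).hcomp ρ).post (α_ g q j).hom = (σ.hcomp (τ.hcomp ρ)).pre (α_ f p i).hom := by
  subst h k l m
  have key : ∀ {f g : a ⟶ b} {p q : b ⟶ c} {i j : c ⟶ d} (σ : f ⟶ g) (τ : p ⟶ q) (ρ : i ⟶ j),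
      ((σ ▷ p ≫ g ◁ τ) ▷ i ≫ (g ≫ q) ◁ ρ) ≫ (α_ g q j).hom =
        (α_ f p i).hom ≫ σ ▷ (p ≫ i) ≫ g ◁ (τ ▷ i ≫ q ◁ ρ) := by
    intros
    simp
  exact key σ τ ρ

theorem unit_hcomp (σ : OverCell h k f g) :
    ((unit h).hcomp σ).post (λ_ g).hom = σ.pre (λ_ f).hom := by
  subst h k
  have key : ∀ {f g : a ⟶ b} (σ : f ⟶ g),
      (𝟙 (𝟙 a) ▷ f ≫ 𝟙 a ◁ σ) ≫ (λ_ g).hom = (λ_ f).hom ≫ σ := by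
    intros
    simp
  exact key σ

theorem hcomp_unit (σ : OverCell h k f g) :
    (σ.hcomp (unit k)).post (ρ_ g).hom = σ.pre (ρ_ f).hom := by
  subst h k
  have key : ∀ {f g : a ⟶ b} (σ : f ⟶ g),
      (σ ▷ 𝟙 b ≫ g ◁ 𝟙 (𝟙 b)) ≫ (ρ_ g).hom = (ρ_ f).hom ≫ σ := by
    intros
    simp
  exact key σ

theorem post_inj {σ τ : OverCell h k f g} (η : g ⟶ g₁) [IsIso η] (e : σ.post η = τ.post η) :
    σ = τ := by
  have := congrArg (fun ρ => post ρ (inv η)) e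
  simpa [post_post, post_id] using this

theorem pre_inj {σ τ : OverCell h k f g} (η : f₁ ⟶ f) [IsIso η] (e : σ.pre η = τ.pre η) :
    σ = τ := by
  have := congrArg (pre (inv η)) e
  simpa [pre_pre, pre_id] using this

end OverCell

/-! ### Factorization of 2-cells between chains -/

section PathCategory

variable {C : Type u'} [Category.{v'} C]

/-- The chain `r` is the fibre over the last index and `θ` is the restriction of `η` to the indices
before it. This is what makes induction on the target of a cell possible. -/
theorem PathCell.exists_eq_whiskerRight_comp_collapse {A B D : PathBicat C} {s : A ⟶ B}
    {t : A ⟶ D} {f : D.as ⟶ B.as} (η : s ⟶ (t ≫ (f.toPath : D ⟶ B))) :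
    ∃ (s' : A ⟶ D) (r : D ⟶ B) (h : s = s' ≫ r) (hr : composePath r = f) (θ : s' ⟶ t),
      η = (isoOfEq h).hom ≫ θ ▷ r ≫ t ◁ (PathCell.collapse r f hr : r ⟶ f.toPath) := by
  obtain ⟨s', r, hs, hr, hu, h⟩ := PathCell.isImage_val η
  obtain rfl : s = s'.comp r := hs
  replace h : IsImage s' t (PathCell.val η) := h
  have hl : ∀ i < Quiver.Path.length s', PathCell.val η i < Quiver.Path.length t := fun i hi =>
    (hu i (by rw [Quiver.Path.length_comp]; omega)).2 hi
  have hm : ∀ i j, i ≤ j → j < Quiver.Path.length s' → PathCell.val η i ≤ PathCell.val η j :=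
    fun i j hij hj => PathCell.val_mono η hij (by rw [Quiver.Path.length_comp]; omega)
  refine ⟨s', r, rfl, hr, PathCell.ofNat (PathCell.val η) hl hm h, ?_⟩
  refine PathCell.ext_val fun i hi => ?_
  have e₁ : PathCell.val η i < Quiver.Path.length t + 1 := PathCell.val_lt η hi
  have e₂ := hu i hi
  rw [Quiver.Path.length_comp] at hi
  rw [val_comp, val_comp, val_isoOfEq_hom]
  have e₃ := val_whiskR (PathCell.ofNat (PathCell.val η) hl hm h : s' ⟶ t) r i
  have e₄ := val_whiskL t (PathCell.collapse r f hr : r ⟶ f.toPath)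
    (PathCell.val (whiskR (PathCell.ofNat (PathCell.val η) hl hm h : s' ⟶ t) r) i)
  refine Eq.trans ?_ e₄.symm
  rw [e₃]
  by_cases h₁ : i < Quiver.Path.length s'
  · rw [if_pos h₁, PathCell.val_ofNat h₁, if_pos (hl i h₁)]
  -- Past `s'` both sides take the value `t.length`, the index of the last arrow `f`.
  · rw [if_neg h₁, if_neg (by omega)]
    have e₅ : PathCell.val (PathCell.collapse r f hr : r ⟶ f.toPath)
        (Quiver.Path.length t + (i - Quiver.Path.length s') - Quiver.Path.length t) = 0 :=
      PathCell.val_ofNat (by omega)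
    rw [e₅]
    have : ¬ PathCell.val η i < Quiver.Path.length t := fun h₂ => h₁ (e₂.1 h₂)
    omega

end PathCategory

/-! ### Naturality and multiplicativity of families of components -/

section Lift

variable {X : Type u} {M : Type u₁} [Bicategory.{w, v} M]
  {F G : CoarsePoint X (BaseOfEnrichment.invertible M)}

instance isIso_map₂ {A B : PathBicat (Codiscrete X)} {s t : A ⟶ B} (η : s ⟶ t) [IsIso η] :
    IsIso (F.map₂ η) :=
  inferInstanceAs (IsIso ((F.mapFunctor A B).map η))

variable {obj_eq : ∀ A : PathBicat (Codiscrete X), F.obj A = G.obj A}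
  (app : ∀ {A B : PathBicat (Codiscrete X)} (t : A ⟶ B),
    OverCell (obj_eq A) (obj_eq B) (F.map t) (G.map t))

/-- Compatibility of a family of 2-cells with a 2-cell between chains. -/
def IsNatural {A B : PathBicat (Codiscrete X)} {s t : A ⟶ B} (η : s ⟶ t) : Prop :=
  (app t).pre (F.map₂ η) = (app s).post (G.map₂ η)

/-- Compatibility of a family of 2-cells with the colaxity 2-cells at two chains. -/
def IsMultiplicative {A B D : PathBicat (Codiscrete X)} (s : A ⟶ B) (t : B ⟶ D) : Prop :=
  ((app s).hcomp (app t)).pre (F.mapComp s t) = (app (s ≫ t)).post (G.mapComp s t)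

variable {app} {A B D E : PathBicat (Codiscrete X)}

theorem IsNatural.id (s : A ⟶ B) : IsNatural app (𝟙 s) := by
  rw [IsNatural, F.map₂_id, G.map₂_id, OverCell.pre_id, OverCell.post_id]

/-- Holds for any family at all, so naturality at associators and unitors comes for free. -/
theorem IsNatural.isoOfEq {s t : A ⟶ B} (h : s = t) : IsNatural app (isoOfEq h).hom := by
  subst h
  exact IsNatural.id s

theorem IsNatural.comp {s t p : A ⟶ B} {η : s ⟶ t} {θ : t ⟶ p} (h : IsNatural app η)
    (h' : IsNatural app θ) : IsNatural app (η ≫ θ) := by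
  rw [IsNatural] at *
  rw [F.map₂_comp, G.map₂_comp, ← OverCell.pre_pre, h', OverCell.pre_post, h, OverCell.post_post]

/-- It suffices to check after the invertible `G.mapComp s' t`, where naturality of the colaxity
cells replaces the image of `η ▷ t` by a whiskered image of `η`. -/
theorem IsNatural.whiskerRight {s s' : A ⟶ B} {η : s ⟶ s'} (h : IsNatural app η) (t : B ⟶ D)
    (hs : IsMultiplicative app s t) (hs' : IsMultiplicative app s' t) :
    IsNatural app (η ▷ t) := by
  rw [IsNatural, IsMultiplicative] at *
  apply OverCell.post_inj (G.mapComp s' t)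
  rw [← OverCell.pre_post, ← hs', OverCell.post_post, G.mapComp_naturality_left,
    OverCell.pre_pre, F.mapComp_naturality_left, ← OverCell.pre_pre, ← OverCell.pre_hcomp, h,
    OverCell.post_hcomp, OverCell.pre_post, hs, OverCell.post_post]

theorem IsNatural.whiskerLeft (s : A ⟶ B) {t t' : B ⟶ D} {η : t ⟶ t'} (h : IsNatural app η)
    (hs : IsMultiplicative app s t) (hs' : IsMultiplicative app s t') :
    IsNatural app (s ◁ η) := by
  rw [IsNatural, IsMultiplicative] at *
  apply OverCell.post_inj (G.mapComp s t')
  rw [← OverCell.pre_post, ← hs', OverCell.post_post, G.mapComp_naturality_right,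
    OverCell.pre_pre, F.mapComp_naturality_right, ← OverCell.pre_pre, ← OverCell.hcomp_pre, h,
    OverCell.hcomp_post, OverCell.pre_post, hs, OverCell.post_post]

/-- `map₂_associator` in `F` and `G` compares the two ways of cutting a triple concatenation; three
of the four cuts being compatible, cancelling isomorphisms gives the fourth. -/
theorem IsMultiplicative.comp {s : A ⟶ B} {t : B ⟶ D} {p : D ⟶ E}
    (h₁ : IsMultiplicative app s t) (h₂ : IsMultiplicative app t p)
    (h₃ : IsMultiplicative app (s ≫ t) p) : IsMultiplicative app s (t ≫ p) := by
  have hα : IsNatural app (α_ s t p).hom := IsNatural.isoOfEq _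
  rw [IsNatural] at hα
  rw [IsMultiplicative] at *
  apply OverCell.pre_inj (F.map₂ (α_ s t p).hom)
  apply OverCell.post_inj (G.map s ◁ G.mapComp t p)
  rw [OverCell.pre_post, hα, OverCell.post_post, OverCell.post_post, G.map₂_associator,
    OverCell.pre_pre, ← OverCell.pre_post, ← OverCell.hcomp_post, ← h₂, OverCell.hcomp_pre,
    OverCell.pre_pre, Category.assoc, F.map₂_associator, ← OverCell.post_post, ← h₃,
    ← OverCell.pre_post, ← OverCell.post_post, ← OverCell.post_hcomp, ← h₁, OverCell.pre_hcomp,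
    ← OverCell.pre_post, OverCell.hcomp_assoc,
    OverCell.pre_pre, OverCell.pre_pre, Category.assoc]

theorem IsMultiplicative.id_right (s : A ⟶ B)
    (h : (OverCell.unit (obj_eq B)).pre (F.mapId B) = (app (𝟙 B)).post (G.mapId B)) :
    IsMultiplicative app s (𝟙 B) := by
  have hρ : IsNatural app (ρ_ s).hom := IsNatural.isoOfEq _
  rw [IsNatural, F.map₂_rightUnitor, G.map₂_rightUnitor] at hρ
  rw [IsMultiplicative]
  apply OverCell.post_inj (G.map s ◁ G.mapId B ≫ (ρ_ _).hom)
  rw [OverCell.post_post, ← hρ, ← OverCell.post_post, ← OverCell.pre_post, ← OverCell.pre_post,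
    ← OverCell.hcomp_post, ← h, OverCell.hcomp_pre, ← OverCell.pre_post,
    OverCell.hcomp_unit]
  simp only [OverCell.pre_pre]

/-- Naturality at `λ_ t`, rewritten with `map₂_leftUnitor`, expresses `app t` through the component
at `𝟙 A ≫ t`, which `h'` expresses through `σ`. -/
theorem app_eq_of_id_left_comp (t : A ⟶ B)
    (h : (OverCell.unit (obj_eq A)).pre (F.mapId A) = (app (𝟙 A)).post (G.mapId A))
    {σ : OverCell (obj_eq A) (obj_eq B) (F.map t) (G.map t)}
    (h' : ((app (𝟙 A)).hcomp σ).pre (F.mapComp (𝟙 A) t) =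
      (app (𝟙 A ≫ t)).post (G.mapComp (𝟙 A) t)) :
    app t = σ := by
  have hl : IsNatural app (λ_ t).hom := IsNatural.isoOfEq _
  rw [IsNatural, G.map₂_leftUnitor, ← OverCell.post_post, ← h', ← OverCell.post_post,
    ← OverCell.pre_post, ← OverCell.post_hcomp, ← h, OverCell.pre_hcomp, ← OverCell.pre_post,
    ← OverCell.pre_post, OverCell.unit_hcomp, OverCell.pre_pre, OverCell.pre_pre, Category.assoc,
    ← F.map₂_leftUnitor] at hl
  exact OverCell.pre_inj _ hl

end Lift

/-! ### Extension from single arrows to chains; full faithfulness -/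

section Lift

variable {X : Type u} {M : Type u₁} [Bicategory.{w, v} M]
  {F G : CoarsePoint X (BaseOfEnrichment.invertible M)}
  {obj_eq : ∀ A : PathBicat (Codiscrete X), F.obj A = G.obj A}
  (τ : ∀ A B : X, OverCell (obj_eq (vert A)) (obj_eq (vert B)) (F.map (edge A B))
    (G.map (edge A B)))

/-- The component at the chain obtained by adding an arrow at the end of a chain `t`, given the
component at `t`. -/
noncomputable def extendByEdge {A : PathBicat (Codiscrete X)} {B D : X} {t : A ⟶ vert B}
    (σ : OverCell (obj_eq A) (obj_eq (vert B)) (F.map t) (G.map t)) :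
    OverCell (obj_eq A) (obj_eq (vert D)) (F.map (t ≫ edge B D)) (G.map (t ≫ edge B D)) :=
  ((σ.hcomp (τ B D)).pre (F.mapComp t (edge B D))).post (inv (G.mapComp t (edge B D)))

/-- The component at a chain of the family of 2-cells that extends a family of 2-cells given on
chains of length one. -/
noncomputable def liftPath {A : PathBicat (Codiscrete X)} : ∀ {B : Codiscrete X}
    (t : Quiver.Path A.as B),
    OverCell (obj_eq A) (obj_eq ⟨B⟩) (F.map (t : A ⟶ ⟨B⟩)) (G.map (t : A ⟶ ⟨B⟩))
  | _, .nil => (OverCell.post (((OverCell.unit (obj_eq A)).pre (F.mapId A)) :)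
      (inv (G.mapId A) :) :)
  | B, @Quiver.Path.cons _ _ _ D _ t _ =>
      extendByEdge (D := B.as) (t := (t : A ⟶ vert D.as)) τ (liftPath t)

/-- The family of 2-cells on all chains that extends a family of 2-cells given on chains of length
one, compatibly with the colaxity 2-cells. -/
noncomputable def lift {A B : PathBicat (Codiscrete X)} (t : A ⟶ B) :
    OverCell (obj_eq A) (obj_eq B) (F.map t) (G.map t) :=
  liftPath τ t

theorem lift_id (A : PathBicat (Codiscrete X)) :
    (OverCell.unit (obj_eq A)).pre (F.mapId A) = (lift τ (𝟙 A)).post (G.mapId A) := by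
  have h : lift τ (𝟙 A) = ((OverCell.unit (obj_eq A)).pre (F.mapId A)).post
    (inv (G.mapId A)) := rfl
  rw [h, OverCell.post_post, IsIso.inv_hom_id, OverCell.post_id]

theorem lift_comp_edge {A : PathBicat (Codiscrete X)} {B D : X} (t : A ⟶ vert B) :
    ((lift τ t).hcomp (τ B D)).pre (F.mapComp t (edge B D)) =
      (lift τ (t ≫ edge B D)).post (G.mapComp t (edge B D)) := by
  have h : lift τ (t ≫ edge B D) = (((lift τ t).hcomp (τ B D)).pre
    (F.mapComp t (edge B D))).post (inv (G.mapComp t (edge B D))) := rfl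
  rw [h, OverCell.post_post, IsIso.inv_hom_id, OverCell.post_id]

/-- The recursion builds this component from that of the empty chain, so `τ A B` is recovered only
after the left unit coherences of `F` and `G` cancel. -/
theorem lift_edge (A B : X) : lift τ (edge A B) = τ A B :=
  app_eq_of_id_left_comp (app := lift τ) (edge A B) (lift_id τ (vert A))
    (lift_comp_edge τ (𝟙 (vert A)))

theorem isMultiplicative_lift_edge {A : PathBicat (Codiscrete X)} {B D : X} (t : A ⟶ vert B) :
    IsMultiplicative (lift τ) t (edge B D) := by
  unfold IsMultiplicative
  beta_reduce
  rw [lift_edge]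
  exact lift_comp_edge τ t

/-- The recursion gives the case where the second chain is one arrow; the cocycle argument of
`IsMultiplicative.comp` then appends arrows one at a time. -/
theorem isMultiplicative_lift {A B D : PathBicat (Codiscrete X)} (s : A ⟶ B) (t : B ⟶ D) :
    IsMultiplicative (lift τ) s t := by
  obtain ⟨D⟩ := D
  change Quiver.Path B.as D at t
  induction t with
  | nil => exact IsMultiplicative.id_right s (lift_id τ B)
  | @cons E D t f ih =>
    exact IsMultiplicative.comp (t := (t : B ⟶ vert E.as)) (p := edge E.as D.as) ih
      (isMultiplicative_lift_edge τ _) (isMultiplicative_lift_edge τ _)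

variable {τ}

theorem isNatural_lift_edgeUnit {A : X}
    (h : (τ A A).pre (inv (F.mapId (vert A)) ≫ F.map₂ (edgeUnit A)) =
      (OverCell.unit (obj_eq (vert A))).post (inv (G.mapId (vert A)) ≫ G.map₂ (edgeUnit A))) :
    IsNatural (lift τ) (edgeUnit A) := by
  unfold IsNatural
  beta_reduce
  rw [lift_edge]
  apply OverCell.pre_inj (inv (F.mapId (vert A)))
  rw [OverCell.pre_pre, h, ← OverCell.post_post, OverCell.pre_post]
  congr 1
  apply OverCell.pre_inj (F.mapId (vert A))
  rw [OverCell.pre_pre, IsIso.hom_inv_id, OverCell.pre_id, OverCell.pre_post, lift_id τ,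
    OverCell.post_post, IsIso.hom_inv_id, OverCell.post_id]

theorem isNatural_lift_edgeComp {A B C : X}
    (h : (τ A C).pre (inv (F.mapComp (edge A B) (edge B C)) ≫ F.map₂ (edgeComp A B C)) =
      ((τ A B).hcomp (τ B C)).post
        (inv (G.mapComp (edge A B) (edge B C)) ≫ G.map₂ (edgeComp A B C))) :
    IsNatural (lift τ) (edgeComp A B C) := by
  have h' := isMultiplicative_lift τ (edge A B) (edge B C)
  unfold IsMultiplicative at h'
  beta_reduce at h'
  rw [lift_edge, lift_edge] at h'
  unfold IsNatural
  beta_reduce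
  rw [lift_edge]
  apply OverCell.pre_inj (inv (F.mapComp (edge A B) (edge B C)))
  rw [OverCell.pre_pre, h, ← OverCell.post_post, OverCell.pre_post]
  congr 1
  apply OverCell.pre_inj (F.mapComp (edge A B) (edge B C))
  rw [OverCell.pre_pre, IsIso.hom_inv_id, OverCell.pre_id, OverCell.pre_post, h',
    OverCell.post_post, IsIso.hom_inv_id, OverCell.post_id]

theorem isNatural_lift_to_edge (hu : ∀ A : X, IsNatural (lift τ) (edgeUnit A))
    (hc : ∀ A B C : X, IsNatural (lift τ) (edgeComp A B C)) {A B : X} (s : vert A ⟶ vert B)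
    (η : s ⟶ edge A B) : IsNatural (lift τ) η := by
  have key : ∀ {B : Codiscrete X} (s : Quiver.Path (Codiscrete.mk A) B)
      (η : (s : vert A ⟶ vert B.as) ⟶ edge A B.as), IsNatural (lift τ) η := by
    intro B s η
    induction s with
    | nil =>
      obtain rfl : η = edgeUnit A := cell_eq _ _
      exact hu A
    | @cons E B s f ih =>
      let θ : (s : vert A ⟶ vert E.as) ⟶ edge A E.as := PathCell.collapse s _ rfl
      -- By uniqueness of cells into a single arrow, any collapse is a collapse of all but the last
      -- arrow followed by one binary composition.
      obtain rfl : η = θ ▷ edge E.as B.as ≫ edgeComp A E.as B.as := cell_eq _ _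
      exact (IsNatural.whiskerRight (ih θ) _ (isMultiplicative_lift τ _ _)
        (isMultiplicative_lift τ _ _)).comp (hc _ _ _)
  exact key s η

theorem isNatural_lift (hu : ∀ A : X, IsNatural (lift τ) (edgeUnit A))
    (hc : ∀ A B C : X, IsNatural (lift τ) (edgeComp A B C))
    {A B : PathBicat (Codiscrete X)} {s t : A ⟶ B} (η : s ⟶ t) : IsNatural (lift τ) η := by
  obtain ⟨B⟩ := B
  change Quiver.Path A.as B at s t
  induction t with
  | nil =>
    -- Only the empty ordinal maps to the empty ordinal.
    obtain rfl : s = .nil := PathCell.isImage_val η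
    obtain rfl : η = 𝟙 (𝟙 A) := PathCell.ext_val fun i hi => absurd hi (Nat.not_lt_zero i)
    exact IsNatural.id _
  | @cons E B t f ih =>
    obtain ⟨s', r, rfl, hr, θ, rfl⟩ := PathCell.exists_eq_whiskerRight_comp_collapse
      (A := A) (B := ⟨B⟩) (D := ⟨E⟩) (s := s) (t := t) (f := f) η
    exact (IsNatural.isoOfEq _).comp
      ((IsNatural.whiskerRight (ih θ) _ (isMultiplicative_lift τ _ _)
        (isMultiplicative_lift τ _ _)).comp
      (IsNatural.whiskerLeft _ (isNatural_lift_to_edge hu hc r _) (isMultiplicative_lift τ _ _)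
        (isMultiplicative_lift τ _ _)))

/-- `mapComp_app` determines the component at a concatenation because `G.mapComp s t` is invertible;
faithfulness rests on this. -/
theorem PathObject.Hom.app_comp_eq {σ σ' : PathObject.Hom F G} {A B D : PathBicat (Codiscrete X)}
    {s : A ⟶ B} {t : B ⟶ D} (hs : σ.app s = σ'.app s) (ht : σ.app t = σ'.app t) :
    σ.app (s ≫ t) = σ'.app (s ≫ t) := by
  apply OverCell.post_inj (G.mapComp s t)
  rw [← σ.mapComp_app, ← σ'.mapComp_app, hs, ht]

theorem PathObject.Hom.app_eq_of_edge {σ σ' : PathObject.Hom F G}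
    (h : ∀ A B : X, σ.app (edge A B) = σ'.app (edge A B)) {A B : PathBicat (Codiscrete X)}
    (t : A ⟶ B) : σ.app t = σ'.app t := by
  obtain ⟨B⟩ := B
  change Quiver.Path A.as B at t
  induction t with
  | nil => exact OverCell.post_inj (G.mapId A) ((σ.mapId_app A).symm.trans (σ'.mapId_app A))
  | @cons E B t f ih =>
    exact app_comp_eq (t := edge E.as B.as) ih (h E.as B.as)

instance : (coarsePointToEnriched X M).Full where
  map_surjective {F G} τ :=
    ⟨{ obj_eq := fun A => τ.obj_eq A.as.as
       app := lift (obj_eq := fun A => τ.obj_eq A.as.as) τ.app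
       naturality := isNatural_lift (fun A => isNatural_lift_edgeUnit (τ.unit_app A))
         fun A B C => isNatural_lift_edgeComp (τ.comp_app A B C)
       mapComp_app := isMultiplicative_lift _
       mapId_app := lift_id _ },
      EnrichedCategoryOn.Hom.ext (by
        funext A B
        exact lift_edge (obj_eq := fun A => τ.obj_eq A.as.as) τ.app A B)⟩

instance : (coarsePointToEnriched X M).Faithful where
  map_injective {F G} σ σ' h := PathObject.Hom.ext (by
    funext A B t
    exact PathObject.Hom.app_eq_of_edge (fun A B =>
      congrFun (congrFun (EnrichedCategoryOn.Hom.ext_iff.1 h) A) B) t)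

instance : (coarsePointToEnriched X M).IsEquivalence where

end Lift

end PathEnrichment

theorem mainTheorem3 (X : Type u) (M : Type u₁) [Bicategory.{w, v} M] :
    (PathEnrichment.coarsePointToEnriched X M).IsEquivalence ∧
      Function.Bijective
        (PathEnrichment.Polyad.toEnriched :
          PathEnrichment.Polyad X M → PathEnrichment.EnrichedCategoryOn X M) := by
  exact ⟨inferInstance, PathEnrichment.Polyad.toEnriched_bijective⟩
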